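/- Let $a, b, n$ be positive integers with $a \le b$, $a \equiv b \pmod 2$, $na$ even, and $n \ge \frac{b(a+b)(a+b+2)}{2a}$. Let $G$ be a finite simple graph of order $n$; if $a$ is odd, assume moreover that $G$ is connected. Suppose that the minimum degree satisfies $\delta(G) \ge a + \frac{b-a}{a}$ and that $$\max\{d_G(u), d_G(v)\} \ge \frac{an}{a+b}$$ for every two distinct nonadjacent vertices $u, v$ of $G$. Then $G$ has an $(a,b)$-parity factor, that is, a spanning subgraph $F$ of $G$ such that $a \le d_F(v) \le b$ and $d_F(v) \equiv b \pmod 2$ for every vertex $v$ of $G$. -/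

import Mathlib

/-- `F` is a `(g, f)`-parity factor of the finite simple graph `G`: a spanning subgraph of `G`
(a graph on the same vertex set, all of whose edges are edges of `G`) such that
`g v ≤ d_F(v) ≤ f v` and `d_F(v) ≡ f v (mod 2)` at every vertex `v`. -/
def IsParityFactor {V : Type*} [Fintype V] (G F : SimpleGraph V) (g f : V → ℕ) : Prop :=
  open Classical in
  F ≤ G ∧ ∀ v : V, g v ≤ F.degree v ∧ F.degree v ≤ f v ∧ F.degree v ≡ f v [MOD 2]

/-- `G` has an `(a, b)`-parity factor: a `(g, f)`-parity factor for the constant functions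
`g = a` and `f = b`. -/
def HasParityFactor {V : Type*} [Fintype V] (G : SimpleGraph V) (a b : ℕ) : Prop :=
  ∃ F : SimpleGraph V, IsParityFactor G F (fun _ => a) (fun _ => b)

/-! A parity factor is encoded as a perfect matching of a gadget graph. If none exists, Tutte's
theorem gives a barrier; a smallest one has such a rigid shape that it projects to disjoint sets S,
T in G and a family P of parts of G - S - T, each C having b|C| + e(T,C) odd, with b|S| + e(T,V∖S) +
2 ≤ |P| + a|T| (`exists_parityBarrier`, the hard half of Lovász's criterion). Here e(A,B) counts
adjacent pairs.

Counting refutes this barrier (`false_of_parityBarrier`). Put M = n/(a+b) and call a vertex low if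
its degree is below aM. By the degree condition the low vertices form a clique, so at most one part
is entirely low. With k = aM - |S|, any other part C satisfies |C| + e(T,C) ≥ k + 1. Summing over P
and inserting the barrier inequality gives kY + 2 + b|S| ≤ bM + (a-1)|T| for the deficiency Y = b|S|
+ e(T,V∖S) - a|T|. As k is usually large, Y must be small; this forces |S| ≤ a and makes T a low
clique with at most a + 1 vertices. The remaining configurations fall to the minimum degree, the
order of G, and connectedness when a is odd. -/

/-! ### Tutte's theorem and smallest barriers -/

/-- `Q` is a family of pairwise disjoint vertex sets of `H - U`, each of which is a union of
connected components of `H - U`. -/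
structure SeparatedFamily {W : Type*} (H : SimpleGraph W) (U : Finset W)
    (Q : Finset (Finset W)) : Prop where
  eq_of_mem : ∀ C ∈ Q, ∀ C' ∈ Q, ∀ x, x ∈ C → x ∈ C' → C = C'
  notMem : ∀ C ∈ Q, ∀ x ∈ C, x ∉ U
  mem_of_adj : ∀ C ∈ Q, ∀ x ∈ C, ∀ y, H.Adj x y → y ∉ U → y ∈ C

namespace SeparatedFamily

variable {W : Type*} {H : SimpleGraph W} {U : Finset W} {Q : Finset (Finset W)}

theorem pairwiseDisjoint (h : SeparatedFamily H U Q) :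
    (Q : Set (Finset W)).PairwiseDisjoint id := by
  intro C hC C' hC' hne
  rw [Function.onFun, Finset.disjoint_left]
  intro x hx hx'
  exact hne (h.eq_of_mem C hC C' hC' x hx hx')

end SeparatedFamily

open Classical in
/-- A graph without perfect matching has a vertex set whose removal leaves more odd parts than it
has elements. -/
theorem exists_oddSeparatedFamily {W : Type*} [Fintype W] (H : SimpleGraph W)
    (hH : ¬ ∃ M : H.Subgraph, M.IsPerfectMatching) :
    ∃ U Q, SeparatedFamily H U Q ∧ (∀ C ∈ Q, Odd C.card) ∧ U.card + 1 ≤ Q.card := by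
  rw [SimpleGraph.tutte] at hH
  push Not at hH
  obtain ⟨u, hu⟩ := hH
  rw [SimpleGraph.IsTutteViolator] at hu
  set K := ((⊤ : H.Subgraph).deleteVerts u).coe with hK
  let f : K.ConnectedComponent → Finset W := fun c => (Subtype.val '' c.supp).toFinset
  have hmem : ∀ c x, x ∈ f c ↔ ∃ y : ((⊤ : H.Subgraph).deleteVerts u).verts,
      K.connectedComponentMk y = c ∧ y.1 = x := by
    intro c x
    simp [f]
  have hcap : ∀ c c' x, x ∈ f c → x ∈ f c' → c = c' := by
    intro c c' x hx hx'
    obtain ⟨y, hy, rfl⟩ := (hmem _ _).1 hx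
    obtain ⟨z, hz, hzy⟩ := (hmem _ _).1 hx'
    rw [← hy, ← hz, Subtype.ext hzy]
  have hinj : Function.Injective f := by
    intro c c' h
    obtain ⟨y, hy⟩ := c.nonempty_supp
    have hx : y.1 ∈ f c := (hmem _ _).2 ⟨y, hy, rfl⟩
    exact hcap c c' _ hx (h ▸ hx)
  refine ⟨u.toFinset, K.oddComponents.toFinset.image f, ⟨?_, ?_, ?_⟩, ?_, ?_⟩
  · intro C hC C' hC' x hx hx'
    obtain ⟨c, -, rfl⟩ := Finset.mem_image.1 hC
    obtain ⟨c', -, rfl⟩ := Finset.mem_image.1 hC'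
    rw [hcap c c' x hx hx']
  · intro C hC x hx
    obtain ⟨c, -, rfl⟩ := Finset.mem_image.1 hC
    obtain ⟨y, -, rfl⟩ := (hmem _ _).1 hx
    have := y.2
    simpa using this
  · intro C hC x hx y hxy hy
    obtain ⟨c, -, rfl⟩ := Finset.mem_image.1 hC
    obtain ⟨z, hz, rfl⟩ := (hmem _ _).1 hx
    have hy' : y ∈ ((⊤ : H.Subgraph).deleteVerts u).verts := by simpa using hy
    refine (hmem _ _).2 ⟨⟨y, hy'⟩, ?_, rfl⟩
    rw [← hz, SimpleGraph.ConnectedComponent.eq]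
    apply SimpleGraph.Adj.reachable
    have hz2 := z.2
    have hz' : z.1 ∉ u := by simpa using hz2
    have hy2 : y ∉ u := by simpa using hy
    simp [hK, hz', hy2, hxy.symm]
  · intro C hC
    obtain ⟨c, hc, rfl⟩ := Finset.mem_image.1 hC
    have hc' : Odd c.supp.ncard := by simpa using hc
    rw [← Set.ncard_image_of_injective c.supp Subtype.val_injective, Set.ncard_eq_toFinset_card'] at hc'
    convert hc'
  · rw [Finset.card_image_of_injective _ hinj, ← Set.ncard_eq_toFinset_card',
      ← Set.ncard_eq_toFinset_card']
    exact hu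

open Classical in
-- Since |W| is even, |U| and the number of odd parts cannot differ by exactly one if the parts
-- exhaust W - U. When they do not, the leftover has odd size and is one more part.
theorem SeparatedFamily.exists_add_two_le {W : Type*} [Fintype W] {H : SimpleGraph W}
    (hW : Even (Fintype.card W)) {U : Finset W} {Q : Finset (Finset W)}
    (hQ : SeparatedFamily H U Q) (hodd : ∀ C ∈ Q, Odd C.card) (hcard : U.card + 1 ≤ Q.card) :
    ∃ Q', SeparatedFamily H U Q' ∧ (∀ C ∈ Q', Odd C.card) ∧ U.card + 2 ≤ Q'.card := by
  by_cases h2 : U.card + 2 ≤ Q.card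
  · exact ⟨Q, hQ, hodd, h2⟩
  have hc : Q.card = U.card + 1 := by omega
  set A := Q.biUnion id with hA
  have hAcard : A.card = ∑ C ∈ Q, C.card := Finset.card_biUnion fun C hC C' hC' hne =>
    hQ.pairwiseDisjoint hC hC' hne
  have hpar : (A.card : ZMod 2) = Q.card := by
    rw [hAcard, Nat.cast_sum, Finset.card_eq_sum_ones, Nat.cast_sum]
    refine Finset.sum_congr rfl fun C hC => ?_
    rw [Nat.cast_one]
    exact (ZMod.natCast_eq_one_iff_odd).2 (hodd C hC)
  have hAU : Disjoint A U := by
    rw [Finset.disjoint_left]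
    intro x hx
    obtain ⟨C, hC, hxC⟩ := Finset.mem_biUnion.1 hx
    exact hQ.notMem C hC x hxC
  -- `B` may be disconnected; this is why parts are only required to be unions of components.
  set B := (A ∪ U)ᶜ with hB
  have hBcard : B.card + A.card + U.card = Fintype.card W := by
    rw [hB, Finset.card_compl, Finset.card_union_of_disjoint hAU]
    have := Finset.card_le_univ (A ∪ U)
    rw [Finset.card_union_of_disjoint hAU] at this
    omega
  have hBodd : Odd B.card := by
    rw [← ZMod.natCast_eq_one_iff_odd]
    have h1 : ((B.card + A.card + U.card : ℕ) : ZMod 2) = 0 := by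
      rw [hBcard, ZMod.natCast_eq_zero_iff_even]; exact hW
    push_cast at h1
    rw [hpar, hc] at h1
    push_cast at h1
    have h3 : (U.card : ZMod 2) + U.card = 0 := CharTwo.add_self_eq_zero _
    have h4 : (1 : ZMod 2) + 1 = 0 := CharTwo.add_self_eq_zero _
    linear_combination h1 - h3 - h4
  have hBQ : B ∉ Q := by
    intro hBQ
    obtain ⟨x, hx⟩ := Finset.card_pos.1 hBodd.pos
    have hxA : x ∈ A := Finset.mem_biUnion.2 ⟨B, hBQ, hx⟩
    have := Finset.mem_compl.1 hx
    exact this (Finset.mem_union_left _ hxA)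
  have hBC : ∀ C ∈ Q, ∀ x ∈ C, x ∉ B := by
    intro C hC x hx hxB
    exact Finset.mem_compl.1 hxB (Finset.mem_union_left _ (Finset.mem_biUnion.2 ⟨C, hC, hx⟩))
  refine ⟨insert B Q, ⟨?_, ?_, ?_⟩, ?_, ?_⟩
  · intro C hC C' hC' x hx hx'
    rcases Finset.mem_insert.1 hC with rfl | hC <;> rcases Finset.mem_insert.1 hC' with rfl | hC'
    · rfl
    · exact (hBC C' hC' x hx' hx).elim
    · exact (hBC C hC x hx hx').elim
    · exact hQ.eq_of_mem C hC C' hC' x hx hx'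
  · intro C hC x hx
    rcases Finset.mem_insert.1 hC with rfl | hC
    · intro hxU
      exact Finset.mem_compl.1 hx (Finset.mem_union_right _ hxU)
    · exact hQ.notMem C hC x hx
  · intro C hC x hx y hxy hy
    rcases Finset.mem_insert.1 hC with rfl | hC
    · rw [hB, Finset.mem_compl, Finset.mem_union, not_or]
      refine ⟨fun hyA => ?_, hy⟩
      obtain ⟨C, hC, hyC⟩ := Finset.mem_biUnion.1 hyA
      have hxU : x ∉ U := fun h => Finset.mem_compl.1 hx (Finset.mem_union_right _ h)
      exact hBC C hC x (hQ.mem_of_adj C hC y hyC x hxy.symm hxU) hx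
    · exact hQ.mem_of_adj C hC x hx y hxy hy
  · intro C hC
    rcases Finset.mem_insert.1 hC with rfl | hC
    · exact hBodd
    · exact hodd C hC
  · rw [Finset.card_insert_of_notMem hBQ]
    omega

open Classical in
/-- In a graph of even order without perfect matching, a smallest set witnessing Tutte's condition
has each of its vertices adjacent to at least three of the odd parts. -/
theorem exists_oddSeparatedFamily_three_le {W : Type*} [Fintype W] (H : SimpleGraph W)
    (hW : Even (Fintype.card W)) (hH : ¬ ∃ M : H.Subgraph, M.IsPerfectMatching) :
    ∃ U Q, SeparatedFamily H U Q ∧ (∀ C ∈ Q, Odd C.card) ∧ U.card + 2 ≤ Q.card ∧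
      ∀ u ∈ U, 3 ≤ (Q.filter fun C => ∃ x ∈ C, H.Adj u x).card := by
  let p : ℕ → Prop := fun m => ∃ U Q, SeparatedFamily H U Q ∧ (∀ C ∈ Q, Odd C.card) ∧
    U.card + 2 ≤ Q.card ∧ U.card = m
  have hp : ∃ m, p m := by
    obtain ⟨U, Q, hQ, hodd, hc⟩ := exists_oddSeparatedFamily H hH
    obtain ⟨Q', hQ', hodd', hc'⟩ := hQ.exists_add_two_le hW hodd hc
    exact ⟨_, U, Q', hQ', hodd', hc', rfl⟩
  obtain ⟨U, Q, hQ, hodd, hc, hm⟩ := Nat.find_spec hp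
  refine ⟨U, Q, hQ, hodd, hc, fun u hu => ?_⟩
  by_contra! hlt
  have hcu : (U.erase u).card + 1 = U.card := Finset.card_erase_add_one hu
  have hsep : SeparatedFamily H (U.erase u) (Q.filter fun C => ¬ ∃ x ∈ C, H.Adj u x) := by
    refine ⟨?_, ?_, ?_⟩
    · intro C hC C' hC' x
      exact hQ.eq_of_mem C (Finset.mem_filter.1 hC).1 C' (Finset.mem_filter.1 hC').1 x
    · intro C hC x hx hxU
      exact hQ.notMem C (Finset.mem_filter.1 hC).1 x hx (Finset.mem_of_mem_erase hxU)
    · intro C hC x hx y hxy hy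
      obtain ⟨hCQ, hC⟩ := Finset.mem_filter.1 hC
      refine hQ.mem_of_adj C hCQ x hx y hxy fun hyU => ?_
      by_cases hyu : y = u
      · subst hyu
        exact hC ⟨x, hx, hxy.symm⟩
      · exact hy (Finset.mem_erase.2 ⟨hyu, hyU⟩)
  have hcard := Finset.card_filter_add_card_filter_not (s := Q) (fun C => ∃ x ∈ C, H.Adj u x)
  -- Freeing `u` costs at most two parts, so the excess over `U.erase u` is still at least one, and
  -- parity lifts it back to two, against minimality.
  obtain ⟨Q', hQ', hodd', hc'⟩ := hsep.exists_add_two_le hW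
    (fun C hC => hodd C (Finset.mem_filter.1 hC).1) (by omega)
  have := Nat.find_min' hp (m := (U.erase u).card) ⟨_, Q', hQ', hodd', hc', rfl⟩
  omega

/-! ### The gadget graph and its perfect matchings -/

/-- A finite set carrying a fixed-point-free involution has an even number of elements. -/
theorem Finset.even_card_of_involution {α : Type*} (s : Finset α) (g : α → α)
    (hmem : ∀ x ∈ s, g x ∈ s) (hne : ∀ x ∈ s, g x ≠ x) (hinv : ∀ x ∈ s, g (g x) = x) :
    Even s.card := by
  rw [← ZMod.natCast_eq_zero_iff_even, Finset.card_eq_sum_ones, Nat.cast_sum]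
  refine Finset.sum_involution (fun x _ => g x) (fun x _ => ?_) (fun x hx _ => hne x hx)
    (fun x hx => hmem x hx) (fun x hx => hinv x hx)
  exact CharTwo.add_self_eq_zero _

/-- The graph whose perfect matchings correspond to the `(a, b)`-parity factors of `G`: every vertex
of `G` is replaced by `b` copies, of which all but the first `a` form a clique, and every edge is
replaced by its two darts, which are adjacent to each other and to the copies of their tails. -/
def parityGadget {V : Type*} (G : SimpleGraph V) (a b : ℕ) :
    SimpleGraph ((V × Fin b) ⊕ G.Dart) where
  Adj x y :=
    match x, y with
    | .inl p, .inl q => p.1 = q.1 ∧ p.2 ≠ q.2 ∧ a ≤ p.2 ∧ a ≤ q.2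
    | .inl p, .inr d => d.fst = p.1
    | .inr d, .inl p => d.fst = p.1
    | .inr d, .inr d' => d' = d.symm
  symm := ⟨by
    rintro (p | d) (q | d') h
    · exact ⟨h.1.symm, h.2.1.symm, h.2.2.2, h.2.2.1⟩
    · exact h
    · exact h
    · rw [show d' = d.symm from h]
      exact (SimpleGraph.Dart.symm_symm d).symm⟩
  loopless := ⟨by
    rintro (p | d) h
    · exact h.2.1 rfl
    · exact (SimpleGraph.Dart.symm_ne d).symm h⟩

namespace parityGadget

variable {V : Type*} {G : SimpleGraph V} {a b : ℕ}

theorem adj_inl_inl {p q : V × Fin b} : (parityGadget G a b).Adj (.inl p) (.inl q) ↔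
    p.1 = q.1 ∧ p.2 ≠ q.2 ∧ a ≤ p.2 ∧ a ≤ q.2 := Iff.rfl

theorem adj_inl_inr {p : V × Fin b} {d : G.Dart} :
    (parityGadget G a b).Adj (.inl p) (.inr d) ↔ d.fst = p.1 := Iff.rfl

theorem adj_inr_inl {p : V × Fin b} {d : G.Dart} :
    (parityGadget G a b).Adj (.inr d) (.inl p) ↔ d.fst = p.1 := Iff.rfl

theorem adj_inr_inr {d d' : G.Dart} :
    (parityGadget G a b).Adj (.inr d) (.inr d') ↔ d' = d.symm := Iff.rfl

open Classical in
-- An edge is kept exactly when its two darts are not matched to each other; each dart is then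
-- matched to a copy of its tail. The copies of v matched to darts count the degree of v, and the
-- others are matched among themselves inside the clique of b - a copies, so they are even in number
-- and at most b - a.
theorem hasParityFactor_of_isPerfectMatching [Fintype V] (hab : a ≤ b)  {M : (parityGadget G a b).Subgraph} (hM : M.IsPerfectMatching) : HasParityFactor G a b := by
  rw [SimpleGraph.Subgraph.isPerfectMatching_iff] at hM
  choose m hm hmu using hM
  have hmm : ∀ x, m (m x) = x := fun x => (hmu (m x) x (hm x).symm).symm
  have hadj : ∀ x, (parityGadget G a b).Adj x (m x) := fun x => (hm x).adj_sub
  have hinj : Function.Injective m := Function.Involutive.injective hmm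
  let F : SimpleGraph V :=
    { Adj := fun u v => ∃ h : G.Adj u v, m (.inr ⟨(u, v), h⟩) ≠ .inr ⟨(v, u), h.symm⟩
      symm := ⟨by
        rintro u v ⟨h, hne⟩
        refine ⟨h.symm, fun h' => hne ?_⟩
        rw [← h', hmm]⟩
      loopless := ⟨fun v h => G.loopless.irrefl v h.1⟩ }
  refine ⟨F, fun u v h => h.1, fun v => ?_⟩
  let A : Finset (Fin b) := Finset.univ.filter fun i => ∃ d, m (.inl (v, i)) = .inr d
  let B : Finset (Fin b) := Finset.univ.filter fun i => ¬ ∃ d, m (.inl (v, i)) = .inr d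
  have hAB : A.card + B.card = b := by
    have := Finset.card_filter_add_card_filter_not (s := (Finset.univ : Finset (Fin b)))
      (fun i => ∃ d, m (.inl (v, i)) = .inr d)
    rwa [Finset.card_univ, Fintype.card_fin] at this
  have hBspec : ∀ i ∈ B, ∃ j, m (.inl (v, i)) = .inl (v, j) ∧ i ≠ j ∧ a ≤ i := by
    intro i hi
    have hi' := (Finset.mem_filter.1 hi).2
    rcases hx : m (.inl (v, i)) with ⟨w, j⟩ | d
    · have := hadj (.inl (v, i))
      rw [hx, adj_inl_inl] at this
      obtain ⟨h1, h2, h3, -⟩ := this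
      have h1' : v = w := h1
      subst h1'
      exact ⟨j, rfl, h2, h3⟩
    · exact (hi' ⟨d, hx⟩).elim
  have hBle : B.card ≤ b - a := by
    have hsub : B.image (fun i : Fin b => (i : ℕ)) ⊆ Finset.Ico a b := by
      intro x hx
      obtain ⟨i, hi, rfl⟩ := Finset.mem_image.1 hx
      obtain ⟨j, -, -, h⟩ := hBspec i hi
      exact Finset.mem_Ico.2 ⟨h, i.2⟩
    have := Finset.card_le_card hsub
    rwa [Finset.card_image_of_injective _ Fin.val_injective, Nat.card_Ico] at this
  have hBeven : Even B.card := by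
    -- The involution is the matching itself; the `else` value is never taken on `B`.
    refine B.even_card_of_involution
      (fun i => if h : ∃ j, m (.inl (v, i)) = .inl (v, j) then h.choose else i) ?_ ?_ ?_
    all_goals
      intro i hi
      obtain ⟨j, hj, hij, -⟩ := hBspec i hi
      have hg : ∀ i j : Fin b, m (.inl (v, i)) = .inl (v, j) →
          (if h : ∃ j, m (.inl (v, i)) = .inl (v, j) then h.choose else i) = j := by
        intro i j hj
        have hex : ∃ j, m (.inl (v, i)) = .inl (v, j) := ⟨j, hj⟩
        rw [dif_pos hex]
        exact (Prod.mk.inj (Sum.inl.inj (hj.symm.trans hex.choose_spec))).2.symm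
      have hji : m (.inl (v, j)) = .inl (v, i) := by rw [← hj, hmm]
      simp only [hg i j hj]
    · refine Finset.mem_filter.2 ⟨Finset.mem_univ _, ?_⟩
      rintro ⟨d, hd⟩
      rw [hji] at hd
      cases hd
    · exact hij.symm
    · exact hg j i hji
  have hdeg : F.degree v = A.card := by
    rw [← SimpleGraph.card_neighborFinset_eq_degree]
    symm
    -- A copy goes to the head of its matched dart; the value `v` is a default never used on `A`.
    refine Finset.card_nbij (fun i => Sum.elim (fun _ => v) (fun d => d.snd) (m (.inl (v, i))))
      ?_ ?_ ?_
    · intro i hi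
      obtain ⟨d, hd⟩ := (Finset.mem_filter.1 hi).2
      have h1 := hadj (.inl (v, i))
      rw [hd, adj_inl_inr] at h1
      obtain ⟨⟨x, y⟩, hxy⟩ := d
      have h1' : x = v := h1
      subst h1'
      simp only [hd, Sum.elim_inr, Finset.mem_coe, SimpleGraph.mem_neighborFinset]
      refine ⟨hxy, fun h => ?_⟩
      rw [← hd, hmm] at h
      cases h
    · intro i hi j hj hij
      obtain ⟨d, hd⟩ := (Finset.mem_filter.1 hi).2
      obtain ⟨e, he⟩ := (Finset.mem_filter.1 hj).2
      have h1 := hadj (.inl (v, i))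
      rw [hd, adj_inl_inr] at h1
      have h2 := hadj (.inl (v, j))
      rw [he, adj_inl_inr] at h2
      simp only [hd, he, Sum.elim_inr] at hij
      have hde : d = e := by
        apply SimpleGraph.Dart.ext
        exact Prod.ext (h1.trans h2.symm) hij
      have := hinj (hd.trans (hde ▸ he.symm))
      exact (Prod.mk.inj (Sum.inl.inj this)).2
    · intro u hu
      obtain ⟨h, hne⟩ := (SimpleGraph.mem_neighborFinset _ _ _).1 (Finset.mem_coe.1 hu)
      rcases hx : m (.inr ⟨(v, u), h⟩) with ⟨w, i⟩ | d
      · have h1 := hadj (.inr ⟨(v, u), h⟩)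
        rw [hx, adj_inr_inl] at h1
        have h1' : v = w := h1
        subst h1'
        have hmi : m (.inl (v, i)) = .inr ⟨(v, u), h⟩ := by rw [← hx, hmm]
        refine ⟨i, Finset.mem_coe.2 (Finset.mem_filter.2 ⟨Finset.mem_univ _, _, hmi⟩), ?_⟩
        simp only [hmi, Sum.elim_inr]
      · have h1 := hadj (.inr ⟨(v, u), h⟩)
        rw [hx, adj_inr_inr] at h1
        rw [h1] at hx
        exact (hne hx).elim
  have hF : ∀ inst : Fintype (F.neighborSet v), @SimpleGraph.degree V F v inst = A.card :=
    fun inst => by convert hdeg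
  have hA : A.card ≡ b [MOD 2] := by
    have := (Nat.even_iff).1 hBeven
    rw [Nat.ModEq]
    omega
  exact ⟨(show a ≤ A.card by omega).trans_eq (hF _).symm,
    (hF _).trans_le (show A.card ≤ b by omega), by rwa [hF]⟩

end parityGadget

/-! ### Counting adjacent pairs -/

open Classical in
/-- The number of pairs `(x, y)` of adjacent vertices with `x ∈ A` and `y ∈ B`. -/
noncomputable def adjCount {V : Type*} (G : SimpleGraph V) (A B : Finset V) : ℕ :=
  ∑ x ∈ A, (B.filter (G.Adj x)).card

section adjCount

variable {V : Type*} {G : SimpleGraph V}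

open Classical in
theorem adjCount_comm (A B : Finset V) : adjCount G A B = adjCount G B A := by
  simp only [adjCount, Finset.card_filter]
  rw [Finset.sum_comm]
  simp only [G.adj_comm]

open Classical in
theorem adjCount_compl_add [Fintype V] (A S : Finset V) :
    adjCount G A Sᶜ + adjCount G A S = adjCount G A Finset.univ := by
  simp only [adjCount]
  rw [← Finset.sum_add_distrib]
  refine Finset.sum_congr rfl fun x _ => ?_
  rw [add_comm, ← Finset.card_union_of_disjoint, ← Finset.filter_union, Finset.union_compl]
  exact Finset.disjoint_filter_filter disjoint_compl_right

open Classical in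
theorem card_darts_eq_adjCount [Fintype V] (A B : Finset V) :
    (Finset.univ.filter fun d : G.Dart => d.fst ∈ A ∧ d.snd ∈ B).card = adjCount G A B := by
  rw [adjCount, ← Finset.card_sigma]
  refine Finset.card_nbij (fun d => ⟨d.fst, d.snd⟩) ?_ ?_ ?_
  · intro d hd
    obtain ⟨h1, h2⟩ := (Finset.mem_filter.1 hd).2
    exact Finset.mem_coe.2 (Finset.mem_sigma.2 ⟨h1, Finset.mem_filter.2 ⟨h2, d.adj⟩⟩)
  · intro d _ e _ h
    apply SimpleGraph.Dart.ext
    simp only [Sigma.mk.injEq, heq_eq_eq] at h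
    exact Prod.ext h.1 h.2
  · rintro ⟨x, y⟩ h
    obtain ⟨h1, h2⟩ := Finset.mem_sigma.1 (Finset.mem_coe.1 h)
    obtain ⟨h2, h3⟩ := Finset.mem_filter.1 h2
    exact ⟨⟨(x, y), h3⟩, Finset.mem_coe.2 (Finset.mem_filter.2 ⟨Finset.mem_univ _, h1, h2⟩), rfl⟩

end adjCount

/-! ### From a gadget barrier to Lovász's criterion -/

/-- Applied to the parts adjacent to a barrier vertex: neighbours of kind `q` all lie in one part,
so two parts are reached through kind `p`. -/
theorem Finset.exists_two_of_three_le_card {α : Type*} {s : Finset α} (hs : 3 ≤ s.card)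
    (p q : α → Prop) (hpq : ∀ x ∈ s, p x ∨ q x)
    (hq : ∀ x ∈ s, ∀ y ∈ s, q x → q y → x = y) : ∃ x ∈ s, ∃ y ∈ s, x ≠ y ∧ p x ∧ p y := by
  classical
  have h1 : (s.filter q).card ≤ 1 := Finset.card_le_one.2 fun x hx y hy =>
    hq x (Finset.mem_filter.1 hx).1 y (Finset.mem_filter.1 hy).1 (Finset.mem_filter.1 hx).2
      (Finset.mem_filter.1 hy).2
  have h2 := Finset.card_filter_add_card_filter_not (s := s) q
  obtain ⟨x, hx, y, hy, hxy⟩ := Finset.one_lt_card.1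
    (show 1 < (s.filter fun x => ¬ q x).card by omega)
  obtain ⟨hx, hqx⟩ := Finset.mem_filter.1 hx
  obtain ⟨hy, hqy⟩ := Finset.mem_filter.1 hy
  exact ⟨x, hx, y, hy, hxy, (hpq x hx).resolve_right hqx, (hpq y hy).resolve_right hqy⟩

theorem SeparatedFamily.card_le_of_forall_exists_mem {W β : Type*} {H : SimpleGraph W}
    {U : Finset W} {Q Q' : Finset (Finset W)} (hQ : SeparatedFamily H U Q) (hQ' : Q' ⊆ Q)
    (D : Finset β) (f : β → W) (h : ∀ C ∈ Q', ∃ d ∈ D, f d ∈ C) : Q'.card ≤ D.card := by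
  rcases Q'.eq_empty_or_nonempty with rfl | ⟨C₀, hC₀⟩
  · simp
  have : Nonempty β := ⟨(h C₀ hC₀).choose⟩
  choose! g hgD hg using h
  refine Finset.card_le_card_of_injOn g (fun C hC => hgD C hC) fun C hC C' hC' heq => ?_
  exact hQ.eq_of_mem C (hQ' hC) C' (hQ' hC') (f (g C)) (hg C hC) (heq ▸ hg C' hC')

theorem Fin.card_filter_le_val (a b : ℕ) :
    ((Finset.univ : Finset (Fin b)).filter fun i : Fin b => a ≤ (i : ℕ)).card = b - a := by
  rw [← Nat.card_Ico, ← Finset.card_image_of_injective _ Fin.val_injective]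
  congr 1
  ext x
  simp only [Finset.mem_image, Finset.mem_filter, Finset.mem_univ, true_and, Finset.mem_Ico]
  constructor
  · rintro ⟨i, hi, rfl⟩
    exact ⟨hi, i.2⟩
  · rintro ⟨h1, h2⟩
    exact ⟨⟨x, h2⟩, h1, rfl⟩

theorem Fin.card_filter_val_lt_le (a b : ℕ) :
    ((Finset.univ : Finset (Fin b)).filter fun i : Fin b => (i : ℕ) < a).card ≤ a := by
  have hsub : ((Finset.univ : Finset (Fin b)).filter fun i : Fin b => (i : ℕ) < a).image
      (fun i : Fin b => (i : ℕ)) ⊆ Finset.range a := by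
    intro x hx
    obtain ⟨i, hi, rfl⟩ := Finset.mem_image.1 hx
    exact Finset.mem_range.2 (Finset.mem_filter.1 hi).2
  have := Finset.card_le_card hsub
  rwa [Finset.card_image_of_injective _ Fin.val_injective, Finset.card_range] at this

namespace parityGadget

variable {V : Type*} {G : SimpleGraph V} {a b : ℕ}

open Classical in
theorem even_card [Fintype V] (h : Even (b * Fintype.card V)) :
    Even (Fintype.card ((V × Fin b) ⊕ G.Dart)) := by
  rw [Fintype.card_sum, Fintype.card_prod, Fintype.card_fin, G.dart_card_eq_twice_card_edges,
    mul_comm]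
  exact h.add (even_two_mul _)

section Barrier

variable {U : Finset ((V × Fin b) ⊕ G.Dart)} {Q : Finset (Finset ((V × Fin b) ⊕ G.Dart))}

theorem eq_of_clique_mem (hQ : SeparatedFamily (parityGadget G a b) U Q) {v : V}
    {C C' : Finset ((V × Fin b) ⊕ G.Dart)} (hC : C ∈ Q) (hC' : C' ∈ Q)
    (h : ∃ j : Fin b, a ≤ j ∧ Sum.inl (v, j) ∈ C)
    (h' : ∃ j : Fin b, a ≤ j ∧ Sum.inl (v, j) ∈ C') : C = C' := by
  obtain ⟨i, hi, hiC⟩ := h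
  obtain ⟨j, hj, hjC⟩ := h'
  by_cases hij : i = j
  · subst hij
    exact hQ.eq_of_mem C hC C' hC' _ hiC hjC
  · exact hQ.eq_of_mem C hC C' hC' (.inl (v, j))
      (hQ.mem_of_adj C hC _ hiC _ (adj_inl_inl.2 ⟨rfl, hij, hi, hj⟩) (hQ.notMem C' hC' _ hjC)) hjC

open Classical in
-- The reverse dart accounts for one part only, so two parts contain copies of the tail. A dart with
-- that tail outside U would be adjacent to both and merge them.
theorem dart_mem_barrier (hQ : SeparatedFamily (parityGadget G a b) U Q)
    (h3 : ∀ u ∈ U, 3 ≤ (Q.filter fun C => ∃ x ∈ C, (parityGadget G a b).Adj u x).card)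
    {d d' : G.Dart} (hd : .inr d ∈ U) (hdd' : d'.fst = d.fst) : .inr d' ∈ U := by
  obtain ⟨C, hC, C', hC', hne, ⟨i, hi⟩, ⟨j, hj⟩⟩ := Finset.exists_two_of_three_le_card (h3 _ hd)
    (fun C => ∃ i, .inl (d.fst, i) ∈ C) (fun C => .inr d.symm ∈ C) (by
      intro C hC
      obtain ⟨-, x, hx, hadj⟩ := Finset.mem_filter.1 hC
      rcases x with ⟨v, i⟩ | e
      · rw [adj_inr_inl] at hadj
        have hv : d.fst = v := hadj
        exact .inl ⟨i, hv ▸ hx⟩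
      · rw [adj_inr_inr] at hadj
        exact .inr (hadj ▸ hx))
    (fun C hC C' hC' h h' => hQ.eq_of_mem C (Finset.mem_filter.1 hC).1 C'
      (Finset.mem_filter.1 hC').1 _ h h')
  have hC := (Finset.mem_filter.1 hC).1
  have hC' := (Finset.mem_filter.1 hC').1
  by_contra hU
  exact hne (hQ.eq_of_mem C hC C' hC' (.inr d')
    (hQ.mem_of_adj C hC _ hi _ (adj_inl_inr.2 hdd') hU)
    (hQ.mem_of_adj C' hC' _ hj _ (adj_inl_inr.2 hdd') hU))

open Classical in
-- All darts at this vertex are in U, so a copy in U could reach parts only through the clique,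
-- which meets at most one part.
theorem copy_notMem_barrier (hQ : SeparatedFamily (parityGadget G a b) U Q)
    (h3 : ∀ u ∈ U, 3 ≤ (Q.filter fun C => ∃ x ∈ C, (parityGadget G a b).Adj u x).card)
    {d : G.Dart} (hd : .inr d ∈ U) (i : Fin b) : .inl (d.fst, i) ∉ U := by
  intro hU
  obtain ⟨C, hC, C', hC', hne, h, h'⟩ := Finset.exists_two_of_three_le_card (h3 _ hU)
    (fun C => False) (fun C => ∃ j : Fin b, a ≤ j ∧ .inl (d.fst, j) ∈ C) (by
      intro C hC
      obtain ⟨hCQ, x, hx, hadj⟩ := Finset.mem_filter.1 hC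
      rcases x with ⟨v, j⟩ | e
      · rw [adj_inl_inl] at hadj
        have hv : d.fst = v := hadj.1
        exact .inr ⟨j, hadj.2.2.2, hv ▸ hx⟩
      · rw [adj_inl_inr] at hadj
        exact (hQ.notMem C hCQ _ hx (dart_mem_barrier hQ h3 hd hadj)).elim)
    (fun C hC C' hC' h h' => eq_of_clique_mem hQ (Finset.mem_filter.1 hC).1
      (Finset.mem_filter.1 hC').1 h h')
  exact h

open Classical in
-- The clique accounts for one part only, so two parts contain darts at v. Any copy of v outside U
-- would join them.
theorem copy_mem_barrier (hQ : SeparatedFamily (parityGadget G a b) U Q)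
    (h3 : ∀ u ∈ U, 3 ≤ (Q.filter fun C => ∃ x ∈ C, (parityGadget G a b).Adj u x).card)
    {v : V} {i : Fin b} (hi : .inl (v, i) ∈ U) (j : Fin b) : .inl (v, j) ∈ U := by
  by_contra hU
  obtain ⟨C, hC, C', hC', hne, ⟨d, hd, hdC⟩, ⟨e, he, heC⟩⟩ :=
    Finset.exists_two_of_three_le_card (h3 _ hi)
    (fun C => ∃ d : G.Dart, d.fst = v ∧ .inr d ∈ C)
    (fun C => ∃ j : Fin b, a ≤ j ∧ .inl (v, j) ∈ C) (by
      intro C hC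
      obtain ⟨hCQ, x, hx, hadj⟩ := Finset.mem_filter.1 hC
      rcases x with ⟨w, j⟩ | e
      · rw [adj_inl_inl] at hadj
        have hv : v = w := hadj.1
        exact .inr ⟨j, hadj.2.2.2, hv ▸ hx⟩
      · rw [adj_inl_inr] at hadj
        exact .inl ⟨e, hadj, hx⟩)
    (fun C hC C' hC' h h' => eq_of_clique_mem hQ (Finset.mem_filter.1 hC).1
      (Finset.mem_filter.1 hC').1 h h')
  have hC := (Finset.mem_filter.1 hC).1
  have hC' := (Finset.mem_filter.1 hC').1
  exact hne (hQ.eq_of_mem C hC C' hC' (.inl (v, j))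
    (hQ.mem_of_adj C hC _ hdC _ (adj_inr_inl.2 hd) hU)
    (hQ.mem_of_adj C' hC' _ heC _ (adj_inr_inl.2 he) hU))

end Barrier

open Classical in
/-- The projection to `G` of a part `C` of the gadget that contains no private copy of a vertex
of `T` and no dart from `S` to `T` inherits the parity of `C`. -/
theorem odd_mul_card_add_adjCount [Fintype V] {U : Finset ((V × Fin b) ⊕ G.Dart)}
    {Q : Finset (Finset ((V × Fin b) ⊕ G.Dart))} (hb : 0 < b) (hba : Even (b - a))
    (hQ : SeparatedFamily (parityGadget G a b) U Q)
    {S T : Finset V} (hS : ∀ v i, .inl (v, i) ∈ U ↔ v ∈ S)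
    (hT : ∀ d : G.Dart, .inr d ∈ U ↔ d.fst ∈ T) (hdeg : ∀ v, ∃ w, G.Adj v w)
    {C : Finset ((V × Fin b) ⊕ G.Dart)} (hC : C ∈ Q)
    (hCT : ∀ v ∈ T, ∀ i : Fin b, i < a → .inl (v, i) ∉ C)
    (hCS : ∀ d : G.Dart, d.fst ∈ S → d.snd ∈ T → .inr d ∉ C) {A : Finset V}
    (hA : ∀ v, v ∈ A ↔ v ∉ T ∧ ∃ i, .inl (v, i) ∈ C) (hodd : Odd C.card) :
    Odd (b * A.card + adjCount G T A) := by
  have hdart : ∀ v ∈ A, ∀ d : G.Dart, d.fst = v → .inr d ∈ C := by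
    intro v hv d hd
    obtain ⟨hvT, i, hi⟩ := (hA v).1 hv
    exact hQ.mem_of_adj C hC _ hi _ (adj_inl_inr.2 hd) (by rwa [hT, hd])
  have hcopy : ∀ d : G.Dart, d.fst ∉ S → .inr d ∈ C → ∀ j, .inl (d.fst, j) ∈ C := by
    intro d hd hdC j
    exact hQ.mem_of_adj C hC _ hdC _ (adj_inr_inl.2 rfl) (by rwa [hS])
  -- Copies of index below `a` are linked only through darts, so a vertex without neighbours would
  -- fail here.
  have hcopies : ∀ v ∈ A, ∀ j, .inl (v, j) ∈ C := by
    intro v hv j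
    obtain ⟨w, hw⟩ := hdeg v
    obtain ⟨hvT, i, hi⟩ := (hA v).1 hv
    have hvS : v ∉ S := fun h => hQ.notMem C hC _ hi ((hS v i).2 h)
    exact hcopy ⟨(v, w), hw⟩ hvS (hdart v hv _ rfl) j
  -- Parity count of `C`: a vertex of `T` contributes its whole clique of b - a copies or nothing,
  -- other vertices contribute b copies each, darts with head outside `T` pair off with their
  -- reverses, and darts into `T` give e(T,A).
  have hleft1 : Even (C.toLeft.filter fun p => p.1 ∈ T).card := by
    have : (C.toLeft.filter fun p => p.1 ∈ T) =
        (T.filter fun v => ∃ i, .inl (v, i) ∈ C) ×ˢ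
          (Finset.univ.filter fun i : Fin b => a ≤ (i : ℕ)) := by
      ext ⟨v, i⟩
      simp only [Finset.mem_filter, Finset.mem_toLeft, Finset.mem_product, Finset.mem_univ,
        true_and]
      constructor
      · rintro ⟨hi, hv⟩
        exact ⟨⟨hv, i, hi⟩, not_lt.1 fun h => hCT v hv i h hi⟩
      · rintro ⟨⟨hv, j, hj⟩, hi⟩
        refine ⟨?_, hv⟩
        by_cases hij : j = i
        · rwa [← hij]
        · refine hQ.mem_of_adj C hC _ hj _
            (adj_inl_inl.2 ⟨rfl, hij, not_lt.1 fun h => hCT v hv j h hj, hi⟩) ?_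
          have := hQ.notMem C hC _ hj
          rw [hS] at this ⊢
          exact this
    rw [this, Finset.card_product, Fin.card_filter_le_val]
    exact hba.mul_left _
  have hleft2 : (C.toLeft.filter fun p => ¬ p.1 ∈ T).card = b * A.card := by
    have : (C.toLeft.filter fun p => ¬ p.1 ∈ T) = A ×ˢ (Finset.univ : Finset (Fin b)) := by
      ext ⟨v, i⟩
      simp only [Finset.mem_filter, Finset.mem_toLeft, Finset.mem_product, Finset.mem_univ,
        and_true]
      constructor
      · rintro ⟨hi, hv⟩
        exact (hA v).2 ⟨hv, i, hi⟩
      · intro hv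
        exact ⟨hcopies v hv i, ((hA v).1 hv).1⟩
    rw [this, Finset.card_product, Finset.card_univ, Fintype.card_fin, mul_comm]
  have hright1 : Even (C.toRight.filter fun d => ¬ d.snd ∈ T).card := by
    refine Finset.even_card_of_involution _ SimpleGraph.Dart.symm ?_
      (fun d _ => d.symm_ne) (fun d _ => d.symm_symm)
    intro d hd
    obtain ⟨hdC, hdT⟩ := Finset.mem_filter.1 hd
    rw [Finset.mem_toRight] at hdC
    refine Finset.mem_filter.2 ⟨Finset.mem_toRight.2 ?_, ?_⟩
    · exact hQ.mem_of_adj C hC _ hdC _ (adj_inr_inr.2 rfl) (by rw [hT]; exact hdT)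
    · have := hQ.notMem C hC _ hdC
      rwa [hT] at this
  have hright2 : (C.toRight.filter fun d => d.snd ∈ T).card = adjCount G T A := by
    rw [adjCount_comm, ← card_darts_eq_adjCount]
    congr 1
    ext d
    simp only [Finset.mem_filter, Finset.mem_toRight, Finset.mem_univ, true_and]
    constructor
    · rintro ⟨hdC, hdT⟩
      have h1 := hQ.notMem C hC _ hdC
      rw [hT] at h1
      exact ⟨(hA _).2 ⟨h1, ⟨0, hb⟩, hcopy d (fun h => hCS d h hdT hdC) hdC _⟩, hdT⟩
    · rintro ⟨hdA, hdT⟩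
      exact ⟨hdart _ hdA d rfl, hdT⟩
  have h1 := Finset.card_filter_add_card_filter_not (s := C.toLeft) (fun p => p.1 ∈ T)
  have h2 := Finset.card_filter_add_card_filter_not (s := C.toRight) (fun d => d.snd ∈ T)
  have h3 := C.card_toLeft_add_card_toRight
  rw [← h3, ← h1, ← h2, hleft2, hright2] at hodd
  rw [Nat.even_iff] at hleft1 hright1
  rw [Nat.odd_iff] at hodd ⊢
  omega

end parityGadget

open Classical in
/-- The nontrivial half of Lovász's criterion for `(a, b)`-parity factors, for graphs without
isolated vertices. -/
theorem exists_parityBarrier {V : Type*} [Fintype V] {G : SimpleGraph V} {a b : ℕ} (hb : 0 < b)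
    (hab : a ≤ b) (hpar : a ≡ b [MOD 2]) (heven : Even (b * Fintype.card V))
    (hdeg : ∀ v, ∃ w, G.Adj v w) (hG : ¬ HasParityFactor G a b) :
    ∃ S T P, Disjoint S T ∧ SeparatedFamily G (S ∪ T) P ∧
      (∀ C ∈ P, Odd (b * C.card + adjCount G T C)) ∧
      b * S.card + adjCount G T Sᶜ + 2 ≤ P.card + a * T.card := by
  have hba : Even (b - a) := by
    rw [Nat.even_sub hab, Nat.even_iff, Nat.even_iff, hpar]
  obtain ⟨U, Q, hQ, hodd, hcard, h3⟩ := exists_oddSeparatedFamily_three_le (parityGadget G a b)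
    (parityGadget.even_card heven)
    (fun ⟨M, hM⟩ => hG (parityGadget.hasParityFactor_of_isPerfectMatching hab hM))
  let T : Finset V := Finset.univ.filter fun v => ∃ d : G.Dart, d.fst = v ∧ .inr d ∈ U
  let S : Finset V := Finset.univ.filter fun v => ∃ i, .inl (v, i) ∈ U
  have hT : ∀ d : G.Dart, .inr d ∈ U ↔ d.fst ∈ T := by
    intro d
    refine ⟨fun h => Finset.mem_filter.2 ⟨Finset.mem_univ _, d, rfl, h⟩, fun h => ?_⟩
    obtain ⟨-, e, he, heU⟩ := Finset.mem_filter.1 h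
    exact parityGadget.dart_mem_barrier hQ h3 heU he.symm
  have hS : ∀ v i, .inl (v, i) ∈ U ↔ v ∈ S := by
    intro v i
    refine ⟨fun h => Finset.mem_filter.2 ⟨Finset.mem_univ _, i, h⟩, fun h => ?_⟩
    obtain ⟨-, j, hj⟩ := Finset.mem_filter.1 h
    exact parityGadget.copy_mem_barrier hQ h3 hj i
  have hST : Disjoint S T := by
    rw [Finset.disjoint_left]
    intro v hvS hvT
    obtain ⟨-, d, rfl, hd⟩ := Finset.mem_filter.1 hvT
    exact parityGadget.copy_notMem_barrier hQ h3 hd ⟨0, hb⟩ ((hS _ _).2 hvS)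
  have hUcard : U.card = b * S.card + adjCount G T Finset.univ := by
    rw [← U.card_toLeft_add_card_toRight, ← card_darts_eq_adjCount]
    congr 1
    · have : U.toLeft = S ×ˢ (Finset.univ : Finset (Fin b)) := by
        ext ⟨v, i⟩
        simp [hS]
      rw [this, Finset.card_product, Finset.card_univ, Fintype.card_fin, mul_comm]
    · congr 1
      ext d
      simp [hT]
  -- The parts that do not project well are charged to distinct private copies over `T`, or to
  -- distinct darts from `S` to `T`.
  let p1 : Finset ((V × Fin b) ⊕ G.Dart) → Prop := fun C =>
    ∃ v ∈ T, ∃ i : Fin b, i < a ∧ .inl (v, i) ∈ C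
  let p2 : Finset ((V × Fin b) ⊕ G.Dart) → Prop := fun C =>
    ∃ d : G.Dart, d.fst ∈ S ∧ d.snd ∈ T ∧ .inr d ∈ C
  have hQ1 : (Q.filter p1).card ≤ a * T.card := by
    refine (hQ.card_le_of_forall_exists_mem (Finset.filter_subset _ _)
      (T ×ˢ Finset.univ.filter fun i : Fin b => (i : ℕ) < a) Sum.inl ?_).trans ?_
    · intro C hC
      obtain ⟨v, hv, i, hi, hC⟩ := (Finset.mem_filter.1 hC).2
      exact ⟨(v, i), Finset.mem_product.2 ⟨hv, Finset.mem_filter.2 ⟨Finset.mem_univ _, hi⟩⟩, hC⟩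
    · rw [Finset.card_product, mul_comm]
      exact Nat.mul_le_mul_right _ (Fin.card_filter_val_lt_le a b)
  have hQ2 : (Q.filter p2).card ≤ adjCount G T S := by
    rw [adjCount_comm, ← card_darts_eq_adjCount]
    refine hQ.card_le_of_forall_exists_mem (Finset.filter_subset _ _) _ Sum.inr ?_
    intro C hC
    obtain ⟨d, h1, h2, hC⟩ := (Finset.mem_filter.1 hC).2
    exact ⟨d, Finset.mem_filter.2 ⟨Finset.mem_univ _, h1, h2⟩, hC⟩
  let A : Finset ((V × Fin b) ⊕ G.Dart) → Finset V := fun C =>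
    Finset.univ.filter fun v => v ∉ T ∧ ∃ i, .inl (v, i) ∈ C
  have hA : ∀ C v, v ∈ A C ↔ v ∉ T ∧ ∃ i, .inl (v, i) ∈ C := by
    intro C v
    simp [A]
  let Q3 := Q.filter fun C => ¬ p1 C ∧ ¬ p2 C
  have hQ3 : ∀ C ∈ Q3, C ∈ Q := fun C hC => (Finset.mem_filter.1 hC).1
  have hPodd : ∀ C ∈ Q3, Odd (b * (A C).card + adjCount G T (A C)) := by
    intro C hC
    obtain ⟨hCQ, h1, h2⟩ := Finset.mem_filter.1 hC
    exact parityGadget.odd_mul_card_add_adjCount hb hba hQ hS hT hdeg hCQ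
      (fun v hv i hi hiC => h1 ⟨v, hv, i, hi, hiC⟩) (fun d hd hd' hdC => h2 ⟨d, hd, hd', hdC⟩)
      (hA C) (hodd C hCQ)
  have hAS : ∀ C ∈ Q, ∀ v ∈ A C, v ∉ S := by
    intro C hC v hv h
    obtain ⟨-, i, hi⟩ := (hA C v).1 hv
    exact hQ.notMem C hC _ hi ((hS v i).2 h)
  have hAdart : ∀ C ∈ Q, ∀ v ∈ A C, ∀ d : G.Dart, d.fst = v → .inr d ∈ C := by
    intro C hC v hv d hd
    obtain ⟨hvT, i, hi⟩ := (hA C v).1 hv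
    exact hQ.mem_of_adj C hC _ hi _ (parityGadget.adj_inl_inr.2 hd) (by rwa [hT, hd])
  have hAeq : ∀ C ∈ Q, ∀ C' ∈ Q, ∀ v, v ∈ A C → v ∈ A C' → C = C' := by
    intro C hC C' hC' v hv hv'
    obtain ⟨w, hw⟩ := hdeg v
    exact hQ.eq_of_mem C hC C' hC' (.inr ⟨(v, w), hw⟩) (hAdart C hC v hv _ rfl)
      (hAdart C' hC' v hv' _ rfl)
  have hinj : Set.InjOn A (Q3 : Set (Finset ((V × Fin b) ⊕ G.Dart))) := by
    intro C hC C' hC' h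
    have hne : (A C).Nonempty := by
      rw [Finset.nonempty_iff_ne_empty]
      intro h0
      -- An empty projection would have parity 0.
      have := hPodd C hC
      rw [h0] at this
      simp [adjCount] at this
    obtain ⟨v, hv⟩ := hne
    exact hAeq C (hQ3 C hC) C' (hQ3 C' hC') v hv (h ▸ hv)
  refine ⟨S, T, Q3.image A, hST, ⟨?_, ?_, ?_⟩, ?_, ?_⟩
  · intro B hB B' hB' v hv hv'
    obtain ⟨C, hC, rfl⟩ := Finset.mem_image.1 hB
    obtain ⟨C', hC', rfl⟩ := Finset.mem_image.1 hB'
    rw [hAeq C (hQ3 C hC) C' (hQ3 C' hC') v hv hv']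
  · intro B hB v hv
    obtain ⟨C, hC, rfl⟩ := Finset.mem_image.1 hB
    rw [Finset.mem_union, not_or]
    exact ⟨hAS C (hQ3 C hC) v hv, ((hA C v).1 hv).1⟩
  · intro B hB v hv w hvw hw
    obtain ⟨C, hC, rfl⟩ := Finset.mem_image.1 hB
    rw [Finset.mem_union, not_or] at hw
    have h1 := hAdart C (hQ3 C hC) v hv ⟨(v, w), hvw⟩ rfl
    have h2 : .inr ⟨(w, v), hvw.symm⟩ ∈ C := hQ.mem_of_adj C (hQ3 C hC) _ h1 _
      (parityGadget.adj_inr_inr.2 rfl) (by rw [hT]; exact hw.2)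
    have h3 : .inl (w, ⟨0, hb⟩) ∈ C := hQ.mem_of_adj C (hQ3 C hC) _ h2 _
      (parityGadget.adj_inr_inl.2 rfl) (by rw [hS]; exact hw.1)
    exact (hA C w).2 ⟨hw.2, _, h3⟩
  · intro B hB
    obtain ⟨C, hC, rfl⟩ := Finset.mem_image.1 hB
    exact hPodd C hC
  · rw [Finset.card_image_of_injOn hinj]
    have hle : Q.card ≤ (Q.filter p1).card + (Q.filter p2).card + Q3.card := by
      refine le_trans (Finset.card_le_card ?_) ((Finset.card_union_le _ _).trans
        (Nat.add_le_add_right (Finset.card_union_le (Q.filter p1) (Q.filter p2)) _))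
      intro C hC
      by_cases h1 : p1 C <;> by_cases h2 : p2 C <;> simp [Q3, hC, h1, h2]
    -- The barrier has b|S| + e(T,V) elements; the e(S,T) parts of the second kind turn e(T,V) into
    -- e(T,V∖S).
    have := adjCount_compl_add (G := G) T S
    omega

/-! ### Numerical contradictions -/

section Arithmetic

variable {a b s t tL tH X XL XH k M q : ℝ}

/-- Here s = |S|, t = |T|, tL and tH count the low and high vertices of T, XL and XH sum their
degrees outside S, and q = |P|. Since a - k ≥ 1, q is at most (a - k)(n - s - t); the tH terms then
cancel, and completing the square in tL leaves k² + 2 ≤ (k+1)²/4. -/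
theorem false_of_deficiency_of_sub_le (ha : 1 ≤ a) (hab : a ≤ b)
    (hM : b * (a + b + 2) ≤ 2 * (a * M)) (hk0 : 0 ≤ k) (hka : k ≤ a - 1) (hks : a * M ≤ k + s)
    (hXL : tL * (tL - 1) ≤ XL) (hXH : k * tH ≤ XH) (hq0 : 0 ≤ q)
    (hq : b * s + (XL + XH) + 2 ≤ q + a * (tL + tH))
    (hqn : q + s + (tL + tH) ≤ (a + b) * M) : False := by
  have h1 : q ≤ (a - k) * ((a + b) * M - s - (tL + tH)) := by
    have : 0 ≤ (a - k - 1) * ((a + b) * M - s - (tL + tH)) :=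
      mul_nonneg (by linarith) (by linarith)
    nlinarith
  have h2 : 0 ≤ (tL - (k + 1) / 2) ^ 2 := sq_nonneg _
  have h3 : (a + b - k) * (a * M - k) ≤ (a + b - k) * s :=
    mul_le_mul_of_nonneg_left (by linarith) (by linarith)
  have hbM : a + b ≤ b * M := by
    have : a * (a + b) ≤ a * (b * M) := by
      have h5 : b * (b * (a + b + 2)) ≤ b * (2 * (a * M)) :=
        mul_le_mul_of_nonneg_left hM (by linarith)
      have h6 : a * (b * (a + b + 2)) ≤ b * (b * (a + b + 2)) :=
        mul_le_mul_of_nonneg_right hab (by nlinarith)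
      have h7 : 2 * (a + b) ≤ b * (a + b + 2) := by nlinarith
      have h8 : a * (2 * (a + b)) ≤ a * (b * (a + b + 2)) :=
        mul_le_mul_of_nonneg_left h7 (by linarith)
      nlinarith
    exact le_of_mul_le_mul_left this (by linarith)
  have h4 : 0 ≤ k * (b * M - (a + b)) := mul_nonneg hk0 (by linarith)
  nlinarith [sq_nonneg (k - 1)]

/-- High vertices contribute nothing negative to Y, and the low clique at least -(a+1)²/4, by
completing the square. The term bs with s ≥ a + 1 outweighs this loss. -/
theorem false_of_deficiency_of_add_one_le (ha : 1 ≤ a) (hab : a ≤ b) (hk0 : 0 ≤ k)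
    (hks : a * M = k + s) (hs : a + 1 ≤ s) (hXL : tL * (tL - 1) ≤ XL) (hXH : a * tH ≤ XH)
    (ht : s + (tL + tH) ≤ (a + b) * M)
    (h : k * (b * s + (XL + XH) - a * (tL + tH)) + 2 + b * s ≤ b * M + (a - 1) * (tL + tH)) :
    False := by
  have h2 : 0 ≤ (tL - (a + 1) / 2) ^ 2 := sq_nonneg _
  have h1 : a * tL - (a + 1) ^ 2 / 4 ≤ XL := by nlinarith
  have h3 : k * (b * s - (a + 1) ^ 2 / 4) ≤ k * (b * s + (XL + XH) - a * (tL + tH)) :=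
    mul_le_mul_of_nonneg_left (by linarith) hk0
  have h4 : (a - 1) * (tL + tH) ≤ (a - 1) * ((a + b) * M - s) :=
    mul_le_mul_of_nonneg_left (by linarith) (by linarith)
  have h5 : (a + 1) ^ 2 / 4 + a + b ≤ b * s + 1 := by
    have : b * (a + 1) ≤ b * s := mul_le_mul_of_nonneg_left hs (by linarith)
    nlinarith [sq_nonneg (a - 1), mul_nonneg (sub_nonneg.2 ha) (sub_nonneg.2 hab)]
  have h6 : 0 ≤ k * (b * s + 1 - ((a + 1) ^ 2 / 4 + a + b)) := mul_nonneg hk0 (by linarith)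
  nlinarith

/-- For t ≥ a + 1 the clique alone gives X ≥ at. For t ≤ a the minimum degree gives a(X - at) ≥ t(b
- a - as), whose worst case is t = 0 or t = a according to sign. -/
theorem le_or_le_of_degree_bounds (ha : 1 ≤ a) (ht0 : 0 ≤ t)
    (ht : t ≤ a ∨ a + 1 ≤ t) (hX : t * (t - 1) ≤ X) (hX' : t * (a ^ 2 + b - a - a * s) ≤ a * X) :
    b * s ≤ b * s + X - a * t ∨ (b - a) * (s + 1) ≤ b * s + X - a * t := by
  rcases ht with ht | ht
  · rcases le_total 0 (b - a - a * s) with h | h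
    · left
      have : 0 ≤ t * (b - a - a * s) := mul_nonneg ht0 h
      have : a * (a * t) ≤ a * X := by nlinarith
      have := le_of_mul_le_mul_left this (by linarith)
      linarith
    · right
      have : a * (b - a - a * s) ≤ t * (b - a - a * s) := mul_le_mul_of_nonpos_right ht h
      have : a * ((b - a) * (s + 1)) ≤ a * (b * s + X - a * t) := by nlinarith
      exact le_of_mul_le_mul_left this (by linarith)
  · left
    nlinarith

/-- A clique of size at least a + 2 has surplus XL - a·tL ≥ tL. For s ≥ 1 the term kbs already
covers bM; for s = 0 the surplus must do so, from the clique bound if b ≤ 2a and from the minimum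
degree if b ≥ 2a. -/
theorem false_of_large_clique (ha : 1 ≤ a) (hab : a ≤ b) (hs : s = 0 ∨ 1 ≤ s) (hk : a ^ 2 ≤ k)
    (hks : a * M = k + s) (htL : a + 2 ≤ tL) (htH : 0 ≤ tH) (hXL : tL * (tL - 1) ≤ XL)
    (hXL' : tL * (a ^ 2 + b - a - a * s) ≤ a * XL) (hXH : k * tH ≤ XH)
    (h : k * (b * s + (XL + XH) - a * (tL + tH)) + 2 + b * s ≤ b * M + (a - 1) * (tL + tH)) :
    False := by
  have hka : a ≤ k := by nlinarith
  have hkH : 0 ≤ (k * (k - a) - (a - 1)) * tH := by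
    refine mul_nonneg ?_ htH
    nlinarith [mul_nonneg (sub_nonneg.2 ha) (sub_nonneg.2 ha)]
  have hXH' : k * (k * tH) ≤ k * XH := mul_le_mul_of_nonneg_left hXH (by linarith)
  have h' : k * (b * s + XL - a * tL) + 2 + b * s ≤ b * M + (a - 1) * tL := by nlinarith
  have h1 : tL * (a + 1) ≤ XL := by nlinarith
  have h'' : a * (k * (b * s + XL - a * tL)) + 2 * a + a * (b * s) ≤
      b * (k + s) + a * ((a - 1) * tL) := by
    have := mul_le_mul_of_nonneg_left h' (by linarith : 0 ≤ a)
    have : a * (b * M) = b * (k + s) := by rw [← hks]; ring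
    nlinarith
  rcases hs with rfl | hs
  · rcases le_total b (2 * a) with hb | hb
    · have h2 : a * (k * (tL * (a + 1))) ≤ a * (k * XL) := by
        gcongr
        linarith
      have h3 : a * ((a + 2) * (k - a + 1)) ≤ a * (tL * (k - a + 1)) := by
        gcongr
      have h4 : b * k ≤ 2 * a * k := mul_le_mul_of_nonneg_right hb (by linarith)
      have h5 : a * (a * a ^ 2) ≤ a * (a * k) := by gcongr
      nlinarith [mul_nonneg (sub_nonneg.2 ha) (sub_nonneg.2 ha),
        mul_nonneg (mul_nonneg (sub_nonneg.2 ha) (sub_nonneg.2 ha)) (by positivity : 0 ≤ a ^ 2 + a)]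
    · have h2 : k * (tL * (a ^ 2 + b - a - a * 0)) ≤ k * (a * XL) :=
        mul_le_mul_of_nonneg_left hXL' (by linarith)
      have hpos : 0 ≤ k * (b - a) - a * (a - 1) := by
        have : a * a ≤ k * (b - a) := mul_le_mul hka (by linarith) (by linarith) (by linarith)
        nlinarith
      have h3 : (a + 2) * (k * (b - a) - a * (a - 1)) ≤ tL * (k * (b - a) - a * (a - 1)) :=
        mul_le_mul_of_nonneg_right htL hpos
      have h4 : b * k ≤ 2 * (b - a) * k :=
        mul_le_mul_of_nonneg_right (by linarith) (by linarith)
      have h5 : a ^ 2 * a ≤ k * (b - a) :=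
        mul_le_mul hk (by linarith) (by linarith) (by linarith)
      have h6 : a * (a ^ 2 * a) ≤ a * (k * (b - a)) := mul_le_mul_of_nonneg_left h5 (by linarith)
      nlinarith [mul_nonneg (sub_nonneg.2 ha) (sub_nonneg.2 ha),
        mul_nonneg (mul_nonneg (sub_nonneg.2 ha) (sub_nonneg.2 ha)) (by linarith : 0 ≤ a)]
  · have h2 : a * (k * (tL * (a + 1))) ≤ a * (k * XL) := by
      gcongr
      linarith
    have h3 : 0 ≤ a * (tL * (k - a + 1)) := by
      refine mul_nonneg (by linarith) (mul_nonneg (by linarith) (by linarith))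
    have h4 : b * k * 1 ≤ b * k * (a * s) := by
      refine mul_le_mul_of_nonneg_left (by nlinarith) (mul_nonneg (by linarith) (by linarith))
    have h5 : 0 ≤ (a - 1) * (b * s) :=
      mul_nonneg (by linarith) (mul_nonneg (by linarith) (by linarith))
    nlinarith

/-- One high vertex adds at least k - a to Y, making the left side quadratic in k, whereas b(a+1) ≤
k + a bounds bM by a smaller quadratic. -/
theorem false_of_exists_high (ha : a = 1 ∨ 2 ≤ a) (hab : a ≤ b) (hs : 0 ≤ s) (hsa : s ≤ a)
    (hk : a ^ 2 ≤ k) (hM : b * (a + b + 2) ≤ 2 * (a * M)) (hks : a * M = k + s)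
    (htL : tL ≤ a + 1) (htH : 1 ≤ tH) (hXL : 0 ≤ b * s + XL - a * tL) (hXH : k * tH ≤ XH)
    (h : k * (b * s + (XL + XH) - a * (tL + tH)) + 2 + b * s ≤ b * M + (a - 1) * (tL + tH)) :
    False := by
  have ha1 : 1 ≤ a := by rcases ha with h | h <;> linarith
  have hka : a ≤ k := by nlinarith
  have hkH : 0 ≤ (k * (k - a) - (a - 1)) * (tH - 1) := by
    refine mul_nonneg ?_ (by linarith)
    nlinarith [mul_nonneg (sub_nonneg.2 ha1) (sub_nonneg.2 ha1)]
  have hXH' : k * (k * tH) ≤ k * XH := mul_le_mul_of_nonneg_left hXH (by linarith)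
  have h1 : 0 ≤ k * (b * s + XL - a * tL) := mul_nonneg (by linarith) hXL
  have h2 : 0 ≤ (a - 1) * (a + 1 - tL) := mul_nonneg (by linarith) (by linarith)
  have h3 : k * (k - a) - (a - 1) - (a ^ 2 - 1) + 2 + b * s ≤ b * M := by nlinarith
  have h4 : a * (k * (k - a) - (a - 1) - (a ^ 2 - 1) + 2) ≤ b * k := by
    have h5 := mul_le_mul_of_nonneg_left h3 (by linarith : 0 ≤ a)
    have h6 : a * (b * M) = b * (k + s) := by rw [← hks]; ring
    have h7 : 0 ≤ (a - 1) * (b * s) :=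
      mul_nonneg (by linarith) (mul_nonneg (by linarith) (by linarith))
    nlinarith
  have h5 : b * (a + 1) ≤ k + a := by nlinarith
  have h6 : k * (b * (a + 1)) ≤ k * (k + a) := mul_le_mul_of_nonneg_left h5 (by linarith)
  have h7 : (a + 1) * (a * (k * (k - a) - (a - 1) - (a ^ 2 - 1) + 2)) ≤ k * (k + a) := by
    have := mul_le_mul_of_nonneg_left h4 (by linarith : 0 ≤ a + 1)
    nlinarith
  rcases ha with rfl | ha
  · nlinarith [sq_nonneg (k - 3 / 2)]
  · obtain ⟨j, rfl⟩ : ∃ j, k = a ^ 2 + j := ⟨k - a ^ 2, by ring⟩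
    obtain ⟨i, rfl⟩ : ∃ i, a = 2 + i := ⟨a - 2, by ring⟩
    have hi : 0 ≤ i := by linarith
    have hj : 0 ≤ j := by linarith
    ring_nf at h7
    have : 0 < 1 + (i + j) := by positivity
    nlinarith [mul_nonneg hi hj, mul_nonneg hi hi, mul_nonneg (mul_nonneg hi hi) hi,
      mul_nonneg hj hj, mul_nonneg (mul_nonneg hi hi) hj,
      mul_nonneg (mul_nonneg hi hi) (mul_nonneg hi hi),
      mul_nonneg (mul_nonneg hi hi) (mul_nonneg hi hj),
      mul_nonneg (mul_nonneg hi hi) (mul_nonneg hj hj), mul_nonneg hi (mul_nonneg hj hj),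
      mul_nonneg (mul_nonneg (mul_nonneg hi hi) (mul_nonneg hi hi)) hi,
      mul_nonneg (mul_nonneg (mul_nonneg hi hi) (mul_nonneg hi hi)) (mul_nonneg hi hi),
      mul_nonneg (mul_nonneg (mul_nonneg hi hi) (mul_nonneg hi hi)) hj]

/-- With `Y` the deficiency term, the counting inequality fails once `Y` is large. -/
theorem false_of_add_le_mul {Y : ℝ} (ha : a = 1 ∨ 2 ≤ a) (hb : 0 ≤ b) (hs : 0 ≤ s)
    (hk : a ^ 2 ≤ k) (hks : a * M = k + s) (ht : t ≤ a + 1)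
    (hY : (a = 1 ∧ b ≤ Y) ∨ a + b ≤ a * Y)
    (h : k * Y + 2 + b * s ≤ b * M + (a - 1) * t) : False := by
  have ha1 : 1 ≤ a := by rcases ha with h | h <;> linarith
  have hk0 : 0 ≤ k := by nlinarith
  rcases hY with ⟨rfl, hY⟩ | hY
  · have : k * b ≤ k * Y := mul_le_mul_of_nonneg_left hY hk0
    nlinarith
  · have h1 := mul_le_mul_of_nonneg_left h (by linarith : 0 ≤ a)
    have h2 : a * (b * M) = b * (k + s) := by rw [← hks]; ring
    have h3 : k * (a + b) ≤ k * (a * Y) := mul_le_mul_of_nonneg_left hY hk0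
    have h4 : 0 ≤ (a - 1) * (a + 1 - t) := mul_nonneg (by linarith) (by linarith)
    have h5 : 0 ≤ a * ((a - 1) * (a + 1 - t)) := mul_nonneg (by linarith) h4
    have h6 : 0 ≤ (a - 1) * (b * s) := mul_nonneg (by linarith) (mul_nonneg hb hs)
    have h7 : a * a ^ 2 ≤ a * k := mul_le_mul_of_nonneg_left hk (by linarith)
    nlinarith

theorem le_of_deficiency_of_add_two_le {Y : ℝ} (ha : a = 1 ∨ 2 ≤ a) (hab : a + 2 ≤ b) (hs : 1 ≤ s)
    (hY : b * s ≤ Y ∨ (b - a) * (s + 1) ≤ Y) : (a = 1 ∧ b ≤ Y) ∨ a + b ≤ a * Y := by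
  rcases ha with rfl | ha
  · left
    refine ⟨rfl, ?_⟩
    rcases hY with hY | hY <;> nlinarith
  · right
    rcases hY with hY | hY
    · have : b ≤ Y := by nlinarith
      nlinarith
    · have h1 : 2 * (b - a) ≤ Y := by nlinarith
      have h2 : a * (2 * (b - a)) ≤ a * Y := mul_le_mul_of_nonneg_left h1 (by linarith)
      nlinarith [mul_nonneg (by linarith : 0 ≤ a - 2) (by linarith : 0 ≤ b - a - 2)]

/-- Completing the square in t gives Y ≥ aM - (a+1)²/4, and aM is at least b(a+b+2)/2. -/
theorem le_of_many_edges (ha : a = 1 ∨ 2 ≤ a) (hab : a ≤ b) (hs : 0 ≤ s)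
    (hM : b * (a + b + 2) ≤ 2 * (a * M)) (hks : a * M = k + s) (hX : k + t * (t - 1) ≤ X) :
    (a = 1 ∧ b ≤ b * s + X - a * t) ∨ a + b ≤ a * (b * s + X - a * t) := by
  have ha1 : 1 ≤ a := by rcases ha with h | h <;> linarith
  have h1 : 0 ≤ (b - 1) * s := mul_nonneg (by linarith) hs
  have h2 : 0 ≤ (t - (a + 1) / 2) ^ 2 := sq_nonneg _
  have h3 : a * M - (a + 1) ^ 2 / 4 ≤ b * s + X - a * t := by nlinarith
  rcases ha with rfl | ha
  · left
    refine ⟨rfl, ?_⟩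
    nlinarith
  · right
    have h4 : a * (a * M - (a + 1) ^ 2 / 4) ≤ a * (b * s + X - a * t) :=
      mul_le_mul_of_nonneg_left h3 (by linarith)
    have h5 : a * (b * (a + b + 2)) ≤ a * (2 * (a * M)) := mul_le_mul_of_nonneg_left hM (by linarith)
    have h6 : a * (b * (2 * a + 2)) ≤ a * (b * (a + b + 2)) :=
      mul_le_mul_of_nonneg_left
        (mul_le_mul_of_nonneg_left (by linarith) (by linarith)) (by linarith)
    have h7 : (a * (a + 1) - 1) * a ≤ (a * (a + 1) - 1) * b :=
      mul_le_mul_of_nonneg_left hab (by nlinarith)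
    nlinarith [mul_nonneg (by linarith : 0 ≤ a - 2) (by linarith : 0 ≤ a - 2),
      mul_nonneg (mul_nonneg (by linarith : 0 ≤ a - 2) (by linarith : 0 ≤ a - 2)) (by linarith : 0 ≤ a)]

/-- If s = 0, the minimum degree gives a(Y + 2) ≥ a + b, so the parts alone exceed n. If a = b, then
n = 2(k + s) forces t + 2 ≤ s; hence Y ≥ s(a - t) ≥ 1, which is again too much. -/
theorem false_of_all_large (ha : 1 ≤ a) (hab : a ≤ b) (hs : 0 ≤ s) (hsa : s ≤ a) (hk : a ^ 2 ≤ k)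
    (hks : a * M = k + s) (ht : 1 ≤ t) (hX0 : 0 ≤ X) (hsb : s = 0 ∨ a = b)
    (hX : t * (a ^ 2 + b - a - a * s) ≤ a * X) (hY0 : 0 ≤ b * s + X - a * t)
    (hq : b * s + X + 2 ≤ q + a * t) (h : (k + 1) * q + s + t ≤ (a + b) * M) : False := by
  have hk0 : 0 ≤ k := by nlinarith
  have hka : a ≤ k := by nlinarith
  have h1 : (k + 1) * (b * s + X - a * t + 2) ≤ (k + 1) * q :=
    mul_le_mul_of_nonneg_left (by linarith) (by linarith)
  rcases hsb with rfl | rfl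
  · have h2 : t * (b - a) ≤ a * (X - a * t) := by nlinarith
    have h3 : b - a ≤ t * (b - a) := by nlinarith
    have h4 : (k + 1) * (b + a) ≤ (k + 1) * (a * (X - a * t + 2)) :=
      mul_le_mul_of_nonneg_left (by linarith) (by linarith)
    have h5 := mul_le_mul_of_nonneg_left h (by linarith : 0 ≤ a)
    have h6 : a * ((a + b) * M) = (a + b) * k := by
      rw [show a * ((a + b) * M) = (a + b) * (a * M) by ring, hks, add_zero]
    nlinarith
  · have h2 : (a + a) * M = 2 * (k + s) := by rw [← hks]; ring
    have h3 : 0 ≤ (k + 1) * (a * s + X - a * t) := mul_nonneg (by linarith) hY0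
    have h4 : t + 2 ≤ s := by nlinarith
    have h5 : 1 ≤ a * s + X - a * t := by nlinarith
    have h6 : (k + 1) * 1 ≤ (k + 1) * (a * s + X - a * t) :=
      mul_le_mul_of_nonneg_left h5 (by linarith)
    nlinarith

/-- The low part has c vertices, all joined to T. First Y ≥ 1, and the order of G then forces t + 3
≤ s; this improves the bound to Y ≥ s(a - t) ≥ 3, which is impossible. -/
theorem false_of_low_part {c : ℝ} (ha : 1 ≤ a) (hs : 1 ≤ s) (hsa : s ≤ a) (hk : a ^ 2 ≤ k)
    (hks : a * M = k + s) (ht : 1 ≤ t) (hc : 1 ≤ c) (htc : t + c ≤ a ∨ a + 1 ≤ t + c)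
    (hX0 : 0 ≤ X) (hX : t * (t - 1 + c) ≤ X) (hX' : t * (a - s) ≤ X)
    (hq : a * s + X + 2 ≤ q + a * t)
    (h : (k + 1) * (q - 1) + c + s + t ≤ (a + a) * M) : False := by
  have hk0 : 0 ≤ k := by nlinarith
  have hka : a ≤ k := by nlinarith
  have h2 : (a + a) * M = 2 * (k + s) := by rw [← hks]; ring
  have hY : 1 ≤ a * s + X - a * t := by
    rcases htc with h | h
    · have : 1 ≤ (a - t) * s := by nlinarith
      nlinarith
    · have : t * a ≤ t * (t - 1 + c) := mul_le_mul_of_nonneg_left (by linarith) (by linarith)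
      nlinarith
  have h1 : (k + 1) * (a * s + X - a * t + 1) ≤ (k + 1) * (q - 1) :=
    mul_le_mul_of_nonneg_left (by linarith) (by linarith)
  have h3 : (k + 1) * 1 ≤ (k + 1) * (a * s + X - a * t) :=
    mul_le_mul_of_nonneg_left hY (by linarith)
  have h4 : t + 3 ≤ s := by nlinarith
  have h5 : 3 ≤ a * s + X - a * t := by nlinarith
  have h6 : (k + 1) * 3 ≤ (k + 1) * (a * s + X - a * t) :=
    mul_le_mul_of_nonneg_left h5 (by linarith)
  nlinarith

theorem sq_le_sub (ha : 1 ≤ a) (hab : a ≤ b) (hsa : s ≤ a) (hM : b * (a + b + 2) ≤ 2 * (a * M))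
    (hks : a * M = k + s) : a ^ 2 ≤ k := by
  nlinarith

end Arithmetic

/-! ### Size and edge bounds for parts -/

section Counting

open Classical in
theorem SeparatedFamily.sum_adjCount_add_le {V : Type*} [Fintype V] {G : SimpleGraph V}
    {S T : Finset V} {P : Finset (Finset V)} (hST : Disjoint S T)
    (hP : SeparatedFamily G (S ∪ T) P) :
    ∑ C ∈ P, adjCount G T C + adjCount G T T ≤ adjCount G T Sᶜ := by
  simp only [adjCount]
  rw [Finset.sum_comm, ← Finset.sum_add_distrib]
  refine Finset.sum_le_sum fun x _ => ?_
  rw [← Finset.card_biUnion, ← Finset.card_union_of_disjoint]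
  · refine Finset.card_le_card fun y hy => ?_
    rcases Finset.mem_union.1 hy with hy | hy
    · obtain ⟨C, hC, hy⟩ := Finset.mem_biUnion.1 hy
      obtain ⟨hyC, hxy⟩ := Finset.mem_filter.1 hy
      exact Finset.mem_filter.2 ⟨Finset.mem_compl.2 fun h =>
        hP.notMem C hC y hyC (Finset.mem_union_left _ h), hxy⟩
    · obtain ⟨hyT, hxy⟩ := Finset.mem_filter.1 hy
      exact Finset.mem_filter.2
        ⟨Finset.mem_compl.2 fun h => Finset.disjoint_left.1 hST h hyT, hxy⟩
  · rw [Finset.disjoint_left]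
    intro y hy hyT
    obtain ⟨C, hC, hy⟩ := Finset.mem_biUnion.1 hy
    exact hP.notMem C hC y (Finset.mem_filter.1 hy).1
      (Finset.mem_union_right _ (Finset.mem_filter.1 hyT).1)
  · intro C hC C' hC' hne
    exact Finset.disjoint_filter_filter (hP.pairwiseDisjoint hC hC' hne)

open Classical in
theorem SeparatedFamily.card_add_sum_card_le {V : Type*} [Fintype V] {G : SimpleGraph V}
    {S T : Finset V} {P : Finset (Finset V)} (hST : Disjoint S T)
    (hP : SeparatedFamily G (S ∪ T) P) :
    S.card + T.card + ∑ C ∈ P, C.card ≤ Fintype.card V := by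
  have h : ∑ C ∈ P, C.card = (P.biUnion id).card :=
    (Finset.card_biUnion fun C hC C' hC' hne => hP.pairwiseDisjoint hC hC' hne).symm
  rw [h, ← Finset.card_union_of_disjoint hST, ← Finset.card_union_of_disjoint]
  · exact Finset.card_le_univ _
  · rw [Finset.disjoint_right]
    intro y hy
    obtain ⟨C, hC, hy⟩ := Finset.mem_biUnion.1 hy
    exact hP.notMem C hC y hy

open Classical in
theorem SeparatedFamily.card_adj_lt {V : Type*} [Fintype V] {G : SimpleGraph V}
    {S T : Finset V} {P : Finset (Finset V)} (hP : SeparatedFamily G (S ∪ T) P)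
    {C : Finset V} (hC : C ∈ P) {v : V} (hv : v ∈ C) :
    (Finset.univ.filter (G.Adj v)).card + 1 ≤ C.card + S.card + (T.filter (G.Adj v)).card := by
  have h1 := Finset.card_erase_add_one hv
  have h2 : (Finset.univ.filter (G.Adj v)).card ≤
      (C.erase v ∪ S ∪ T.filter (G.Adj v)).card := by
    refine Finset.card_le_card fun y hy => ?_
    have hy := (Finset.mem_filter.1 hy).2
    by_cases hyS : y ∈ S
    · exact Finset.mem_union_left _ (Finset.mem_union_right _ hyS)
    · by_cases hyT : y ∈ T
      · exact Finset.mem_union_right _ (Finset.mem_filter.2 ⟨hyT, hy⟩)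
      · refine Finset.mem_union_left _ (Finset.mem_union_left _
          (Finset.mem_erase.2 ⟨hy.ne', hP.mem_of_adj C hC v hv y hy ?_⟩))
        rw [Finset.mem_union, not_or]
        exact ⟨hyS, hyT⟩
  have h3 := Finset.card_union_le (C.erase v ∪ S) (T.filter (G.Adj v))
  have h4 := Finset.card_union_le (C.erase v) S
  omega

open Classical in
/-- If every vertex of `C` that has few neighbours is joined to `T`, then a vertex of `C` with many
neighbours forces `C` to be large or to send many edges to `T`. -/
theorem SeparatedFamily.large_or_many_edges {V : Type*} [Fintype V] {G : SimpleGraph V}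
    {S T : Finset V} {P : Finset (Finset V)} (hP : SeparatedFamily G (S ∪ T) P) {C : Finset V}
    (hC : C ∈ P) {N k : ℝ} (hk : N = k + S.card)
    (hlow : ∀ v ∈ C, ((Finset.univ.filter (G.Adj v)).card : ℝ) < N → ∃ x ∈ T, G.Adj v x)
    {w : V} (hw : w ∈ C) (hwN : N ≤ (Finset.univ.filter (G.Adj w)).card) :
    k + 1 ≤ C.card ∨ k ≤ adjCount G T C := by
  by_cases hlarge : k + 1 ≤ C.card
  · exact .inl hlarge
  right
  push Not at hlarge
  have hbound : ∀ v ∈ C, N ≤ (Finset.univ.filter (G.Adj v)).card →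
      k + 1 - C.card ≤ (T.filter (G.Adj v)).card := by
    intro v hv h
    have : ((Finset.univ.filter (G.Adj v)).card : ℝ) + 1 ≤
        C.card + S.card + (T.filter (G.Adj v)).card := mod_cast hP.card_adj_lt hC hv
    linarith
  have hone : ∀ v ∈ C, 1 ≤ (T.filter (G.Adj v)).card := by
    intro v hv
    by_cases h : N ≤ (Finset.univ.filter (G.Adj v)).card
    · have h1 := hbound v hv h
      have h2 : (0 : ℝ) < (T.filter (G.Adj v)).card := by linarith
      exact_mod_cast h2
    · obtain ⟨x, hx, hvx⟩ := hlow v hv (not_le.1 h)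
      exact Finset.card_pos.2 ⟨x, Finset.mem_filter.2 ⟨hx, hvx⟩⟩
  -- `w` sends at least k + 1 - |C| edges to `T` and each of the other |C| - 1 vertices at least
  -- one: k in total.
  have hsum : adjCount G T C = (T.filter (G.Adj w)).card +
      ∑ v ∈ C.erase w, (T.filter (G.Adj v)).card := by
    rw [adjCount_comm, adjCount, Finset.add_sum_erase C (fun v => (T.filter (G.Adj v)).card) hw]
  have hge : (C.erase w).card ≤ ∑ v ∈ C.erase w, (T.filter (G.Adj v)).card := by
    rw [Finset.card_eq_sum_ones]
    exact Finset.sum_le_sum fun v hv => hone v (Finset.mem_of_mem_erase hv)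
  have h1 := Finset.card_erase_add_one hw
  have h2 := hbound w hw hwN
  have h3 : (C.card : ℝ) ≤ ∑ v ∈ C.erase w, ((T.filter (G.Adj v)).card : ℝ) + 1 := by
    rw [← h1]
    push_cast
    have : ((C.erase w).card : ℝ) ≤ ∑ v ∈ C.erase w, ((T.filter (G.Adj v)).card : ℝ) := by
      exact_mod_cast hge
    linarith
  rw [hsum]
  push_cast
  linarith

end Counting

/-! ### No barrier exists under the degree conditions -/

set_option maxHeartbeats 800000 in
open Classical in
theorem false_of_parityBarrier {V : Type*} [Fintype V] {G : SimpleGraph V} {a b : ℕ} {M : ℝ}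
    (ha : 0 < a) (hab : a = b ∨ a + 2 ≤ b) (hconn : Odd b → G.Connected)
    (hn : (Fintype.card V : ℝ) = (a + b) * M) (hM : (b : ℝ) * (a + b + 2) ≤ 2 * (a * M))
    (hmin : ∀ v, (a : ℝ) ^ 2 + b - a ≤ a * (Finset.univ.filter (G.Adj v)).card)
    (hlow : ∀ u v, u ≠ v → ((Finset.univ.filter (G.Adj u)).card : ℝ) < a * M →
      ((Finset.univ.filter (G.Adj v)).card : ℝ) < a * M → G.Adj u v)
    {S T : Finset V} {P : Finset (Finset V)} (hST : Disjoint S T)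
    (hP : SeparatedFamily G (S ∪ T) P)
    (hodd : ∀ C ∈ P, Odd (b * C.card + adjCount G T C))
    (hdef : b * S.card + adjCount G T Sᶜ + 2 ≤ P.card + a * T.card) : False := by
  set dg : V → ℕ := fun v => (Finset.univ.filter (G.Adj v)).card with hdg
  set d : V → ℕ := fun v => (Sᶜ.filter (G.Adj v)).card with hd
  have ha1 : (1 : ℝ) ≤ a := mod_cast ha
  have ha2 : (a : ℝ) = 1 ∨ (2 : ℝ) ≤ a := by
    rcases Nat.lt_or_ge a 2 with h | h
    · left; have : a = 1 := by omega
      exact_mod_cast this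
    · right; exact_mod_cast h
  have hab' : (a : ℝ) ≤ b := by
    have : a ≤ b := by omega
    exact_mod_cast this
  have hs0 : (0 : ℝ) ≤ S.card := Nat.cast_nonneg _
  have hne : ∀ C ∈ P, C.Nonempty := by
    intro C hC
    rw [Finset.nonempty_iff_ne_empty]
    rintro rfl
    have := hodd _ hC
    simp [adjCount] at this
  have hdS : ∀ x, (dg x : ℝ) ≤ d x + S.card := by
    intro x
    have h1 := adjCount_compl_add (G := G) {x} S
    simp only [adjCount, Finset.sum_singleton] at h1
    have h2 : (S.filter (G.Adj x)).card ≤ S.card := Finset.card_filter_le _ _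
    have h3 : dg x ≤ d x + S.card := by
      simp only [hdg, hd]
      omega
    exact_mod_cast h3
  have hdmin : ∀ x, (a : ℝ) ^ 2 + b - a - a * S.card ≤ a * d x := by
    intro x
    have h1 := hmin x
    have h2 := mul_le_mul_of_nonneg_left (hdS x) (by linarith : (0 : ℝ) ≤ a)
    simp only [hdg] at h1 h2
    linarith
  -- `T` splits into vertices of small and of large degree
  set TL := T.filter fun x => (dg x : ℝ) < a * M with hTL
  set TH := T.filter fun x => ¬ (dg x : ℝ) < a * M with hTH
  have htcard : (T.card : ℝ) = TL.card + TH.card := by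
    exact_mod_cast (Finset.card_filter_add_card_filter_not (s := T)
      (fun x => (dg x : ℝ) < a * M)).symm
  have hX : (adjCount G T Sᶜ : ℝ) = ∑ x ∈ TL, (d x : ℝ) + ∑ x ∈ TH, (d x : ℝ) := by
    rw [Finset.sum_filter_add_sum_filter_not, adjCount]
    push_cast
    rfl
  set XL := ∑ x ∈ TL, (d x : ℝ) with hXL
  set XH := ∑ x ∈ TH, (d x : ℝ) with hXH
  have hTLclique : ∀ x ∈ TL, ∀ y ∈ TL, x ≠ y → G.Adj x y := fun x hx y hy hxy =>
    hlow x y hxy (Finset.mem_filter.1 hx).2 (Finset.mem_filter.1 hy).2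
  have hTLcard : ∀ x ∈ TL, TL.card ≤ (TL.filter (G.Adj x)).card + 1 := by
    intro x hx
    rw [← Finset.card_erase_add_one hx]
    refine Nat.add_le_add_right (Finset.card_le_card fun y hy => ?_) 1
    obtain ⟨hyx, hy⟩ := Finset.mem_erase.1 hy
    exact Finset.mem_filter.2 ⟨hy, hTLclique x hx y hy hyx.symm⟩
  have hTS : T ⊆ Sᶜ := fun y hy => Finset.mem_compl.2 fun h => Finset.disjoint_left.1 hST h hy
  have hXL1 : (TL.card : ℝ) * (TL.card - 1) ≤ XL := by
    rw [hXL, ← nsmul_eq_mul]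
    refine Finset.card_nsmul_le_sum _ _ _ fun x hx => ?_
    have h1 := hTLcard x hx
    have h2 : (TL.filter (G.Adj x)).card ≤ d x := Finset.card_le_card
      (Finset.filter_subset_filter _ ((Finset.filter_subset _ _).trans hTS))
    have : (TL.card : ℝ) ≤ d x + 1 := by
      have : TL.card ≤ d x + 1 := by omega
      exact_mod_cast this
    linarith
  have hXL2 : (TL.card : ℝ) * ((a : ℝ) ^ 2 + b - a - a * S.card) ≤ a * XL := by
    rw [hXL, ← nsmul_eq_mul, Finset.mul_sum]
    exact Finset.card_nsmul_le_sum _ _ _ fun x _ => hdmin x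
  have hXHle : ∀ κ : ℝ, (∀ x ∈ TH, κ ≤ d x) → κ * TH.card ≤ XH := by
    intro κ h
    rw [hXH, mul_comm, ← nsmul_eq_mul]
    exact Finset.card_nsmul_le_sum _ _ _ h
  have hTHd : ∀ x ∈ TH, a * M - S.card ≤ d x := by
    intro x hx
    have h1 := not_lt.1 (Finset.mem_filter.1 hx).2
    have h2 := hdS x
    linarith
  have hXH0 : 0 ≤ XH := Finset.sum_nonneg fun x _ => Nat.cast_nonneg _
  have hXL0 : 0 ≤ XL := Finset.sum_nonneg fun x _ => Nat.cast_nonneg _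
  have hdef' : (b : ℝ) * S.card + (XL + XH) + 2 ≤ P.card + a * (TL.card + TH.card) := by
    rw [← hX, ← htcard]
    exact_mod_cast hdef
  have hsize := hP.card_add_sum_card_le hST
  have hsize' : (S.card : ℝ) + T.card + ∑ C ∈ P, (C.card : ℝ) ≤ (a + b) * M := by
    rw [← hn]
    exact_mod_cast hsize
  have hPle : (P.card : ℝ) ≤ ∑ C ∈ P, (C.card : ℝ) := by
    have : P.card ≤ ∑ C ∈ P, C.card := by
      rw [Finset.card_eq_sum_ones]
      exact Finset.sum_le_sum fun C hC => (hne C hC).card_pos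
    exact_mod_cast this
  obtain ⟨k, hk⟩ : ∃ k : ℝ, (a : ℝ) * M = k + S.card := ⟨a * M - S.card, by ring⟩
  rcases le_or_gt k (a - 1) with hka | hka
  · refine false_of_deficiency_of_sub_le (k := max k 0) (s := S.card) (tL := TL.card)
      (tH := TH.card) (XL := XL) (XH := XH) (q := P.card) ha1 hab' hM (le_max_right _ _)
      (max_le hka (by linarith)) ?_ hXL1 (hXHle _ fun x hx => ?_) (Nat.cast_nonneg _) hdef' ?_
    · have := le_max_left k 0
      linarith
    · refine max_le ?_ (Nat.cast_nonneg _)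
      have := hTHd x hx
      linarith
    · rw [htcard] at hsize'
      linarith
  have hk0 : 0 ≤ k := by linarith
  -- the parts of `G - S - T` split into those with and those without a vertex of large degree
  set PH := P.filter fun C => ∃ v ∈ C, a * M ≤ dg v with hPH
  set PL := P.filter fun C => ¬ ∃ v ∈ C, a * M ≤ dg v with hPL
  have hPcard : P.card = PH.card + PL.card :=
    (Finset.card_filter_add_card_filter_not (s := P) _).symm
  have hPsum : ∀ f : Finset V → ℝ, ∑ C ∈ P, f C = ∑ C ∈ PH, f C + ∑ C ∈ PL, f C := fun f =>
    (Finset.sum_filter_add_sum_filter_not P _ f).symm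
  have hPLlow : ∀ C ∈ PL, ∀ v ∈ C, (dg v : ℝ) < a * M := fun C hC v hv =>
    not_le.1 fun h => (Finset.mem_filter.1 hC).2 ⟨v, hv, h⟩
  have hPL1 : PL.card ≤ 1 := by
    refine Finset.card_le_one.2 fun C hC C' hC' => ?_
    have hCP := (Finset.mem_filter.1 hC).1
    have hCP' := (Finset.mem_filter.1 hC').1
    obtain ⟨u, hu⟩ := hne C hCP
    obtain ⟨v, hv⟩ := hne C' hCP'
    by_cases huv : u = v
    · subst huv
      exact hP.eq_of_mem C hCP C' hCP' u hu hv
    · have hadj := hlow u v huv (hPLlow C hC u hu) (hPLlow C' hC' v hv)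
      exact hP.eq_of_mem C hCP C' hCP' v
        (hP.mem_of_adj C hCP u hu v hadj (hP.notMem C' hCP' v hv)) hv
  have hedges := hP.sum_adjCount_add_le hST
  have hedges' : ∑ C ∈ P, (adjCount G T C : ℝ) + adjCount G T T ≤ XL + XH := by
    rw [← hX]
    exact_mod_cast hedges
  -- Sum |C| + e(T,C) over `P`: at least k + 1 for each part with a high vertex, at least 1 for the
  -- possible low part.
  have hstar : (k + 1) * (P.card - 1) + 1 ≤ (a + b) * M - S.card - T.card + (XL + XH) := by
    have h1 : (PH.card : ℝ) * (k + 1) ≤ ∑ C ∈ PH, ((C.card : ℝ) + adjCount G T C) := by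
      rw [← nsmul_eq_mul]
      refine Finset.card_nsmul_le_sum _ _ _ fun C hC => ?_
      obtain ⟨hCP, v, hv, hvN⟩ := Finset.mem_filter.1 hC
      have h2 : (T.filter (G.Adj v)).card ≤ adjCount G T C := by
        rw [adjCount_comm, adjCount]
        exact Finset.single_le_sum (f := fun v => (T.filter (G.Adj v)).card)
          (fun _ _ => Nat.zero_le _) hv
      have h3 := hP.card_adj_lt hCP hv
      have h4 : (dg v : ℝ) + 1 ≤ C.card + S.card + adjCount G T C := by
        have : dg v + 1 ≤ C.card + S.card + adjCount G T C := by
          simp only [hdg]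
          omega
        exact_mod_cast this
      linarith
    have h2 : (PL.card : ℝ) ≤ ∑ C ∈ PL, ((C.card : ℝ) + adjCount G T C) := by
      rw [← mul_one (PL.card : ℝ), ← nsmul_eq_mul]
      refine Finset.card_nsmul_le_sum _ _ _ fun C hC => ?_
      have h3 : (1 : ℝ) ≤ C.card := mod_cast (hne C (Finset.mem_filter.1 hC).1).card_pos
      have h4 : (0 : ℝ) ≤ adjCount G T C := Nat.cast_nonneg _
      linarith
    have h3 := hPsum fun C => (C.card : ℝ) + adjCount G T C
    rw [Finset.sum_add_distrib] at h3
    have h4 : (0 : ℝ) ≤ adjCount G T T := Nat.cast_nonneg _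
    have h5 : (P.card : ℝ) = PH.card + PL.card := mod_cast hPcard
    have h6 : (PL.card : ℝ) ≤ 1 := mod_cast hPL1
    have h7 : 0 ≤ k * (1 - PL.card) := mul_nonneg hk0 (by linarith)
    rw [h5]
    linarith
  -- Insert |P| ≥ Y + 2 into `hstar`.
  have hstar' : k * (b * S.card + (XL + XH) - a * (TL.card + TH.card)) + 2 + b * S.card ≤
      b * M + (a - 1) * (TL.card + TH.card) := by
    have h1 : 0 ≤ (k + 1) * (P.card + a * (TL.card + TH.card) -
      (b * S.card + (XL + XH) + 2)) := mul_nonneg (by linarith) (by linarith)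
    rw [htcard] at hstar
    linarith
  have hTHk : k * TH.card ≤ XH := hXHle _ fun x hx => by
    have := hTHd x hx
    linarith
  rcases Nat.lt_or_ge a S.card with hsa | hsa
  · refine false_of_deficiency_of_add_one_le (s := S.card) (tL := TL.card) (tH := TH.card)
      ha1 hab' hk0 hk (by exact_mod_cast hsa) hXL1 (hXHle _ fun x hx => ?_) ?_ hstar'
    · have h1 := hTHd x hx
      have h2 : (a : ℝ) < d x + 1 := by linarith
      have h3 : a < d x + 1 := by exact_mod_cast h2
      exact_mod_cast Nat.le_of_lt_succ h3
    · rw [← htcard]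
      have h4 : (0 : ℝ) ≤ P.card := Nat.cast_nonneg _
      linarith
  have hsa' : (S.card : ℝ) ≤ a := mod_cast hsa
  have hkk : (a : ℝ) ^ 2 ≤ k := sq_le_sub ha1 hab' hsa' hM hk
  have hs01 : (S.card : ℝ) = 0 ∨ (1 : ℝ) ≤ S.card := by
    rcases Nat.eq_zero_or_pos S.card with h | h
    · exact .inl (by exact_mod_cast h)
    · exact .inr (by exact_mod_cast h)
  have htL : TL.card ≤ a + 1 := by
    by_contra! h
    exact false_of_large_clique ha1 hab' hs01 hkk hk (by exact_mod_cast h)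
      (Nat.cast_nonneg TH.card) hXL1 hXL2 hTHk hstar'
  have htL' : (TL.card : ℝ) ≤ a + 1 := mod_cast htL
  have hY := le_or_le_of_degree_bounds (b := b) (s := S.card) (t := TL.card) ha1
    (Nat.cast_nonneg _) (by
      rcases Nat.lt_or_ge a TL.card with h | h
      · exact .inr (by exact_mod_cast h)
      · exact .inl (by exact_mod_cast h)) hXL1 hXL2
  have hY0 : 0 ≤ b * S.card + XL - a * TL.card := by
    have h1 : (0 : ℝ) ≤ b * S.card := mul_nonneg (Nat.cast_nonneg _) hs0
    have h2 : (0 : ℝ) ≤ (b - a) * (S.card + 1) := mul_nonneg (by linarith) (by linarith)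
    rcases hY with h | h <;> linarith
  have htH : TH.card = 0 := by
    by_contra h
    have h1 : 1 ≤ TH.card := Nat.one_le_iff_ne_zero.2 h
    exact false_of_exists_high ha2 hab' hs0 hsa' hkk hM hk htL' (by exact_mod_cast h1) hY0 hTHk
      hstar'
  have hTHe : TH = ∅ := Finset.card_eq_zero.1 htH
  have hTTL : TL = T := by
    rw [hTL, Finset.filter_eq_self]
    intro x hx
    by_contra h
    have : x ∈ TH := Finset.mem_filter.2 ⟨hx, h⟩
    simp [hTHe] at this
  have hXHz : XH = 0 := by rw [hXH, hTHe, Finset.sum_empty]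
  rw [hXHz, htH, Nat.cast_zero, add_zero, add_zero, hTTL] at hstar' hdef'
  rw [hXHz, add_zero] at hedges' hX
  rw [hTTL] at hXL1 hXL2 hTLcard hTLclique hY hY0 htL'
  clear_value XL XH
  have hTlow : ∀ x ∈ T, (dg x : ℝ) < a * M := by
    intro x hx
    rw [← hTTL] at hx
    exact (Finset.mem_filter.1 hx).2
  -- without a removed vertex every part is joined to `T`
  have hjoin : S = ∅ → ∀ C ∈ P, (T.Nonempty ∨ ∃ C' ∈ P, C' ≠ C) → 1 ≤ adjCount G T C := by
    intro hS C hC hout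
    by_contra! h
    have h0 : adjCount G T C = 0 := by omega
    have hob := hodd C hC
    rw [h0, add_zero] at hob
    have hconn := hconn (Nat.odd_mul.1 hob).1
    have hTC : ∀ x ∈ C, ∀ y ∈ T, ¬ G.Adj x y := by
      intro x hx y hy hxy
      have : 0 < adjCount G T C := by
        rw [adjCount]
        exact Finset.sum_pos' (fun _ _ => Nat.zero_le _)
          ⟨y, hy, Finset.card_pos.2 ⟨x, Finset.mem_filter.2 ⟨hx, hxy.symm⟩⟩⟩
      omega
    obtain ⟨v, hv⟩ := hne C hC
    have hall : ∀ w, w ∈ C := by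
      intro w
      obtain ⟨p⟩ := hconn.preconnected v w
      induction p with
      | nil => exact hv
      | cons hadj p ih =>
        refine ih (hP.mem_of_adj C hC _ hv _ hadj fun h => ?_)
        rw [hS, Finset.empty_union] at h
        exact hTC _ hv _ h hadj
    rcases hout with ⟨x, hx⟩ | ⟨C', hC', hCC'⟩
    · exact hP.notMem C hC x (hall x) (Finset.mem_union_right _ hx)
    · obtain ⟨x, hx⟩ := hne C' hC'
      exact hCC' (hP.eq_of_mem C' hC' C hC x hx (hall x))
  have hsS : (S.card : ℝ) = 0 → S = ∅ := fun h => Finset.card_eq_zero.1 (by exact_mod_cast h)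
  rcases T.eq_empty_or_nonempty with hT | hT
  · have hXz : XL = 0 := by
      rw [← hX, hT]
      simp [adjCount]
    rw [hXz, hT, Finset.card_empty, Nat.cast_zero] at hstar' hdef'
    rcases hs01 with hs | hs
    · have h2 : 2 ≤ P.card := by
        have : (2 : ℝ) ≤ P.card := by
          rw [hs] at hdef'
          linarith
        exact_mod_cast this
      obtain ⟨C, hC, C', hC', hCC'⟩ := Finset.one_lt_card.1 h2
      have := hjoin (hsS hs) C hC (.inr ⟨C', hC', hCC'.symm⟩)
      rw [hT] at this
      simp [adjCount] at this
    · have h1 := mul_le_mul_of_nonneg_left hstar' (by linarith : (0 : ℝ) ≤ a)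
      have h2 : (a : ℝ) * (b * M) = b * (k + S.card) := by rw [← hk]; ring
      have h3 : 1 ≤ a * (S.card : ℝ) := by nlinarith
      have h4 : (b : ℝ) * k * 1 ≤ b * k * (a * S.card) :=
        mul_le_mul_of_nonneg_left h3 (mul_nonneg (Nat.cast_nonneg _) hk0)
      have h5 : 0 ≤ (a - 1) * ((b : ℝ) * S.card) := mul_nonneg (by linarith) (mul_nonneg (Nat.cast_nonneg _) hs0)
      linarith
  have ht1 : (1 : ℝ) ≤ T.card := mod_cast hT.card_pos
  -- If `S` is nonempty and b ≥ a + 2, then Y is too large for `hstar'`.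
  have hsb : (S.card : ℝ) = 0 ∨ (a : ℝ) = b := by
    rcases hs01 with h | h
    · exact .inl h
    rcases hab with h' | h'
    · exact .inr (by exact_mod_cast h')
    · exact (false_of_add_le_mul ha2 (by linarith) hs0 hkk hk htL'
        (le_of_deficiency_of_add_two_le ha2 (by exact_mod_cast h') h hY) hstar').elim
  have hTT : (T.card : ℝ) * (T.card - 1) ≤ adjCount G T T := by
    rw [adjCount, Nat.cast_sum, ← nsmul_eq_mul]
    refine Finset.card_nsmul_le_sum _ _ _ fun x hx => ?_
    have : (T.card : ℝ) ≤ (T.filter (G.Adj x)).card + 1 := mod_cast hTLcard x hx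
    linarith
  have hfew : ∀ C ∈ P, (adjCount G T C : ℝ) < k := by
    intro C hC
    by_contra! h
    have h1 : (adjCount G T C : ℝ) ≤ ∑ C ∈ P, (adjCount G T C : ℝ) :=
      Finset.single_le_sum (f := fun C => (adjCount G T C : ℝ)) (fun _ _ => Nat.cast_nonneg _) hC
    exact false_of_add_le_mul ha2 (by linarith) hs0 hkk hk htL'
      (le_of_many_edges ha2 hab' hs0 hM hk (t := T.card) (X := XL) (by linarith)) hstar'
  -- `T` is now nonempty and entirely low, so every low vertex of a part is joined to it.
  have hlarge : ∀ C ∈ PH, k + 1 ≤ C.card := by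
    intro C hC
    obtain ⟨hCP, w, hw, hwN⟩ := Finset.mem_filter.1 hC
    refine (hP.large_or_many_edges hCP hk ?_ hw hwN).resolve_right (not_le.2 (hfew C hCP))
    intro v hv hvN
    obtain ⟨x, hx⟩ := hT
    refine ⟨x, hx, hlow v x ?_ hvN (hTlow x hx)⟩
    rintro rfl
    exact hP.notMem C hCP v hv (Finset.mem_union_right _ hx)
  have hPHsum : (k + 1) * PH.card ≤ ∑ C ∈ PH, (C.card : ℝ) := by
    rw [mul_comm, ← nsmul_eq_mul]
    exact Finset.card_nsmul_le_sum _ _ _ hlarge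
  rw [hPsum] at hsize'
  rcases Nat.eq_zero_or_pos PL.card with hPL0 | hPL0
  · have h1 : (P.card : ℝ) = PH.card := by
      rw [hPcard, hPL0, add_zero]
    rw [Finset.card_eq_zero.1 hPL0, Finset.sum_empty] at hsize'
    rw [← h1] at hPHsum
    exact false_of_all_large ha1 hab' hs0 hsa' hkk hk ht1 hXL0 hsb hXL2 hY0 hdef' (by linarith)
  · have hPLone : PL.card = 1 := by omega
    obtain ⟨C, hC⟩ := Finset.card_eq_one.1 hPLone
    have hCPL : C ∈ PL := by rw [hC]; exact Finset.mem_singleton_self C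
    have hCP : C ∈ P := (Finset.mem_filter.1 hCPL).1
    have hCT : adjCount G T C = T.card * C.card := by
      rw [adjCount, ← smul_eq_mul, ← Finset.sum_const]
      refine Finset.sum_congr rfl fun x hx => ?_
      congr 1
      rw [Finset.filter_eq_self]
      intro v hv
      refine hlow x v ?_ (hTlow x hx) (hPLlow C hCPL v hv)
      rintro rfl
      exact hP.notMem C hCP x hv (Finset.mem_union_right _ hx)
    have hc1 : (1 : ℝ) ≤ C.card := mod_cast (hne C hCP).card_pos
    have hPHc : (PH.card : ℝ) = P.card - 1 := by
      rw [hPcard, hPLone]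
      push_cast
      ring
    have hesum := hPsum fun C => (adjCount G T C : ℝ)
    rw [hC, Finset.sum_singleton] at hesum hsize'
    have hCT' : (adjCount G T C : ℝ) = T.card * C.card := mod_cast hCT
    rcases hs01 with hs | hs
    -- Degrees in the low part give t + |C| ≥ a + 1, so edges inside `T` and to `C` number at least
    -- at; with one edge to each other part this exceeds the |P| + at - 2 allowed.
    · have h1 : (PH.card : ℝ) ≤ ∑ C ∈ PH, (adjCount G T C : ℝ) := by
        rw [← mul_one (PH.card : ℝ), ← nsmul_eq_mul]
        refine Finset.card_nsmul_le_sum _ _ _ fun C hC => ?_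
        exact_mod_cast hjoin (hsS hs) C (Finset.mem_filter.1 hC).1 (.inl hT)
      obtain ⟨u, hu⟩ := hne C hCP
      have h2 : (dg u : ℝ) + 1 ≤ C.card + S.card + (T.filter (G.Adj u)).card :=
        mod_cast hP.card_adj_lt hCP hu
      have h3 : ((T.filter (G.Adj u)).card : ℝ) ≤ T.card := mod_cast Finset.card_filter_le _ _
      have h4 : (a : ℝ) ≤ dg u := by
        have : (a : ℝ) * a ≤ a * dg u := by
          have := hmin u
          simp only [hdg]
          linarith
        exact le_of_mul_le_mul_left this (by linarith)
      have h5 : 0 ≤ (T.card : ℝ) * (T.card - 1 + C.card - a) :=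
        mul_nonneg (by linarith) (by linarith)
      rw [hs] at hdef'
      linarith
    · have hbeq : (a : ℝ) = b := by
        rcases hsb with h | h
        · linarith
        · exact h
      have h1 : (0 : ℝ) ≤ ∑ C ∈ PH, (adjCount G T C : ℝ) :=
        Finset.sum_nonneg fun _ _ => Nat.cast_nonneg _
      rw [← hbeq] at hdef' hsize' hXL2
      refine false_of_low_part (c := C.card) ha1 hs hsa' hkk hk ht1 hc1 ?_ hXL0 ?_ ?_ hdef' ?_
      · rcases Nat.lt_or_ge a (T.card + C.card) with h | h
        · exact .inr (by exact_mod_cast h)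
        · exact .inl (by exact_mod_cast h)
      · linarith
      · have : (a : ℝ) * (T.card * (a - S.card)) ≤ a * XL := by linarith
        exact le_of_mul_le_mul_left this (by linarith)
      · rw [← hPHc]
        linarith

theorem theorem3 (a b n : ℕ) (ha : 0 < a) (hab : a ≤ b) (hpar : a ≡ b [MOD 2])
    (hna : Even (n * a))
    (hn : (b : ℝ) * ((a : ℝ) + b) * ((a : ℝ) + b + 2) / (2 * a) ≤ n)
    {V : Type*} [Fintype V] (G : SimpleGraph V) [DecidableRel G.Adj]
    (hcard : Fintype.card V = n)
    (hconn : Odd a → G.Connected)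
    (hmin : (a : ℝ) + ((b : ℝ) - a) / a ≤ G.minDegree)
    (hdeg : ∀ u v : V, u ≠ v → ¬ G.Adj u v →
      (a : ℝ) * n / ((a : ℝ) + b) ≤ max (G.degree u : ℝ) (G.degree v : ℝ)) :
    HasParityFactor G a b := by
  classical
  have ha0 : (0 : ℝ) < a := mod_cast ha
  have hab' : (a : ℝ) ≤ b := mod_cast hab
  have hoddab : Odd a ↔ Odd b := by rw [Nat.odd_iff, Nat.odd_iff, hpar]
  have hdegree : ∀ v, (Finset.univ.filter (G.Adj v)).card = G.degree v := by
    intro v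
    rw [← SimpleGraph.card_neighborFinset_eq_degree, SimpleGraph.neighborFinset_eq_filter]
  have hmin' : ∀ v, (a : ℝ) ^ 2 + b - a ≤ a * G.degree v := by
    intro v
    have h1 : (G.minDegree : ℝ) ≤ G.degree v := mod_cast G.minDegree_le_degree v
    have h2 := mul_le_mul_of_nonneg_left (hmin.trans h1) ha0.le
    have h3 : (a : ℝ) * (a + (b - a) / a) = a ^ 2 + b - a := by
      field_simp
      ring
    linarith
  have heven : Even (b * Fintype.card V) := by
    rw [hcard, Nat.even_mul]
    rw [Nat.even_mul] at hna
    have : Even a ↔ Even b := by rw [Nat.even_iff, Nat.even_iff, hpar]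
    tauto
  have hiso : ∀ v, ∃ w, G.Adj v w := by
    intro v
    have h1 : (0 : ℝ) < a * G.degree v := by
      have := hmin' v
      nlinarith
    have h2 : 0 < G.degree v := by
      have := pos_of_mul_pos_right h1 ha0.le
      exact_mod_cast this
    exact (G.degree_pos_iff_exists_adj v).1 h2
  by_contra hG
  obtain ⟨S, T, P, hST, hP, hodd, hdef⟩ :=
    exists_parityBarrier (by omega) hab hpar heven hiso hG
  -- With M = n/(a+b), the threshold in the degree condition is aM.
  have hM : (a : ℝ) * (n / (a + b)) = a * n / (a + b) := by ring
  refine false_of_parityBarrier (M := n / (a + b)) ha ?_ (fun h => hconn (hoddab.2 h)) ?_ ?_ ?_ ?_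
    hST hP hodd hdef
  · have := hpar
    rw [Nat.ModEq] at this
    omega
  · rw [hcard]
    field_simp
  · rw [div_le_iff₀ (by positivity)] at hn
    rw [hM, ← mul_div_assoc, le_div_iff₀ (by positivity)]
    linarith
  · intro v
    have := hmin' v
    rw [← hdegree] at this
    convert this
  · intro u v huv hu hv
    by_contra hadj
    have h1 := hdeg u v huv hadj
    rw [hM] at hu hv
    have hu' : (G.degree u : ℝ) < a * n / (a + b) := by
      rw [← hdegree]
      convert hu
    have hv' : (G.degree v : ℝ) < a * n / (a + b) := by
      rw [← hdegree]
      convert hv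
    exact absurd h1 (not_le.2 (max_lt hu' hv'))
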